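/- Consider the stable assignment (locally optimal semi-matching) problem: the input is a finite bipartite graph whose two sides are called customers and servers, where every customer has at least one adjacent server. Each customer has to choose exactly one adjacent server. The load $\ell(s)$ of a server $s$ is the number of customers that choose it. The assignment is stable if no customer can benefit from switching alone, i.e. if for every customer $c$ with chosen server $s$ and every other server $s'$ adjacent to $c$ we have $\ell(s)\le \ell(s')+1$. Theorem. There are an absolute constant $K$ and one deterministic algorithm $\mathcal{A}$ in the $\mathsf{LOCAL}$ model (synchronous rounds, unbounded messages and local computation; nodes carry unique identifiers from $\mathbb{N}$, and initially a node knows only its own identifier, the identifiers of its neighbours, and whether it is a customer or a server; in particular no global parameter is known to the nodes) such that on every such input graph, with every assignment of unique identifiers, every node irrevocably produces its output within at most $K\cdot C\cdot S^4$ communication rounds, each customer outputs the identifier of one adjacent server, and the resulting assignment is stable. Here $C$ is the maximum degree of a customer and $S$ is the maximum degree of a server in the input graph. That is, the stable assignment problem can be solved in $O(C\cdot S^4)$ communication rounds in the $\mathsf{LOCAL}$ model. -/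

import Mathlib

universe u

/-! ### Customer-server graphs and stable assignments -/

/-- The two sides of the bipartition. -/
inductive Role where
  | customer
  | server

/-- A bipartite graph with customers on one side and servers on the other. -/
structure CustomerServerGraph (V : Type u) where
  graph : SimpleGraph V
  role : V → Role
  bipartite : ∀ ⦃u v : V⦄, graph.Adj u v → role u ≠ role v

namespace CustomerServerGraph

variable {V : Type u} (N : CustomerServerGraph V)

/-- The type of customers. -/
abbrev Customer : Type u := {v : V // N.role v = Role.customer}

/-- The maximum degree among the nodes of the given role (`0` if there is no such node);
only used for finite `V`. -/
noncomputable def maxDegree (r : Role) : ℕ :=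
  sSup ((fun v => (N.graph.neighborSet v).ncard) '' {v | N.role v = r})

/-- The load of `s`: the number of customers that have chosen `s`. -/
noncomputable def load (σ : N.Customer → V) (s : V) : ℕ :=
  {c : N.Customer | σ c = s}.ncard

/-- Every customer has chosen an adjacent server, and no customer could lower the load that it
experiences by moving, alone, to another adjacent server `s` (whose load would then become
`load s + 1`). -/
def IsStableAssignment (σ : N.Customer → V) : Prop :=
  (∀ c : N.Customer, N.graph.Adj c (σ c)) ∧
    ∀ (c : N.Customer) (s : V), N.graph.Adj c s → s ≠ σ c → N.load σ (σ c) ≤ N.load σ s + 1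

end CustomerServerGraph

/-! ### The LOCAL model -/

/-- A deterministic algorithm in the LOCAL model, run by every node. Inputs are from `I`, outputs
from `O`. Messages and local computations are unrestricted, and nothing in the algorithm depends
on the network.
* `start i x nbrs` is the initial state of a node with identifier `i`, local input `x` and set
  `nbrs` of identifiers of its neighbours;
* `send q j` is the message that a node in state `q` sends to its neighbour with identifier `j`;
* `receive q M` is the new state of a node in state `q` that has received the messages `M`,
  a set of pairs (identifier of the sender, message);
* `output q` is the output that a node in state `q` is ready to announce, if any. -/
structure LocalAlgorithm (I O : Type) where
  State : Type
  Msg : Type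
  start : ℕ → I → Set ℕ → State
  send : State → ℕ → Msg
  receive : State → Set (ℕ × Msg) → State
  output : State → Option O

namespace LocalAlgorithm

variable {I O : Type} (A : LocalAlgorithm I O) {V : Type u}
  (G : SimpleGraph V) (ident : V → ℕ) (input : V → I)

/-- The state of a node after `t` synchronous communication rounds. -/
def stateAt : ℕ → V → A.State
  | 0, v => A.start (ident v) (input v) (ident '' G.neighborSet v)
  | t + 1, v => A.receive (stateAt t v)
      ((fun w => (ident w, A.send (stateAt t w) (ident v))) '' G.neighborSet v)

/-- The output that a node has produced after at most `t` rounds, if any. Outputs are irrevocable: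
the first announced output is the final one. (The node may still forward messages later.) -/
def outputAt : ℕ → V → Option O
  | 0, v => A.output (A.stateAt G ident input 0 v)
  | t + 1, v => match outputAt t v with
    | some o => some o
    | none => A.output (A.stateAt G ident input (t + 1) v)

end LocalAlgorithm

/-- On the network `N` with node identifiers `ident`, the algorithm `A` solves the stable
assignment problem within `T` communication rounds: after `T` rounds every node has produced its
output, and the output of each customer is the identifier of a server, such that these choices
form a stable assignment. The local input of a node is its role. -/
def SolvesStableAssignmentWithin (A : LocalAlgorithm Role ℕ) {V : Type u}
    (N : CustomerServerGraph V) (ident : V → ℕ) (T : ℕ) : Prop :=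
  (∀ v : V, (A.outputAt N.graph ident N.role T v).isSome) ∧
    ∃ σ : N.Customer → V, N.IsStableAssignment σ ∧
      ∀ c : N.Customer, A.outputAt N.graph ident N.role T c = some (ident (σ c))

/-! The dynamics run in phases, and the invariant is that no assigned customer can improve by
switching (`IsBalanced`). At the start of a phase each unassigned customer offers itself to its
least loaded servers, and each server accepts at most one. A server that gains a customer holds a
token, one unit above its load at the start of the phase (its level). A token then drops from a
server to a tokenless server one level lower, carried by a customer that has not yet moved in this
phase. When nothing more can drop, the configuration is balanced again (`IsPhase.isBalanced`).

If all server degrees are at most `S`, dropping stops after `S ^ 3` rounds (`IsPhase.le_of_req`).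
Suppose `u` requests a customer of `v` in round `j`. Following the tokens backwards in time,
downwards from `u` and upwards from `v`, yields at most `S` servers, one per level, such that in
each of the rounds `1` to `j` one of them makes a request. Each request forces a move by a customer
from a fixed set of at most `S ^ 2`, and a customer moves at most once per phase, so a server makes
requests in at most `S ^ 2` of these rounds (`IsPhase.ncard_req_le`).

In each phase an unassigned customer sees some customer within distance two become assigned, so `C *
S` phases suffice (`target_ne_none_of_mul_le`). Tokens originate at unassigned customers nearby, so
a customer with none of these around it is frozen (`target_eq_of_assigned`).

No global parameter is needed. Since phases fall quiet, their outcome does not depend on their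
length once it is large for the nearby degrees (`phaseState_eq_of_le`). Every node therefore
simulates all phase lengths at once and a customer reads its answer from the run fitting the degrees
it has seen, at a time when its view reaches far enough. All these answers agree with the single run
of phase length `3 * S ^ 3`, which is stable. -/

/-! ### One round of token dropping by message passing -/

/-- The least element of a set of natural numbers, if there is one. -/
noncomputable def leastElement (s : Set ℕ) : Option ℕ :=
  open Classical in if s.Nonempty then some (sInf s) else none

theorem mem_of_leastElement {s : Set ℕ} {a : ℕ} (h : leastElement s = some a) : a ∈ s := by
  unfold leastElement at h
  split_ifs at h with hs
  · cases h
    exact Nat.sInf_mem hs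

theorem exists_leastElement {s : Set ℕ} {a : ℕ} (h : a ∈ s) : ∃ b, leastElement s = some b :=
  ⟨sInf s, by unfold leastElement; exact if_pos ⟨a, h⟩⟩

/-- The local state of a node in the token dropping dynamics. Customers use `target` (the
identifier of the chosen server), `moved` (whether that choice was made in the current phase),
`offers` and `choice`; servers use `load`, `base` (the load at the start of the phase), `request`
and `grant`. -/
@[ext] structure Cell where
  target : Option ℕ
  moved : Prop
  load : ℕ
  base : ℕ
  offers : Set ℕ
  request : Option ℕ
  choice : Option ℕ
  grant : Option ℕ

namespace Cell

/-- The initial local state. -/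
def init : Cell := ⟨none, False, 0, 0, ∅, none, none, none⟩

/-- A customer computes the set of servers to which it is willing to move: in the first round of a
phase the servers of least load if it is unassigned, and later the servers without a token one
level below its present server if that server holds a token. -/
def offer (first : Prop) (r : Role) (x : Cell) (M : Set (ℕ × Cell)) : Cell :=
  { x with offers := {j | r = Role.customer ∧ ∃ y, (j, y) ∈ M ∧
      ((first ∧ x.target = none ∧ ∀ k z, (k, z) ∈ M → y.load ≤ z.load) ∨
        (¬ first ∧ ¬ x.moved ∧ ∃ i z, (i, z) ∈ M ∧ x.target = some i ∧ z.base < z.load ∧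
          y.base + 1 = z.base ∧ y.load ≤ y.base))} }

/-- A server requests one of the customers that offered themselves. -/
noncomputable def ask (me : ℕ) (x : Cell) (M : Set (ℕ × Cell)) : Cell :=
  { x with request := leastElement {i | ∃ y, (i, y) ∈ M ∧ me ∈ y.offers} }

/-- A customer chooses one of the servers that requested it. -/
noncomputable def choose (me : ℕ) (x : Cell) (M : Set (ℕ × Cell)) : Cell :=
  { x with choice := leastElement {j | ∃ y, (j, y) ∈ M ∧ y.request = some me} }

/-- A server permits one of its customers to leave. -/
noncomputable def permit (me : ℕ) (x : Cell) (M : Set (ℕ × Cell)) : Cell :=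
  { x with grant := leastElement {i | ∃ y, (i, y) ∈ M ∧ y.target = some me ∧ y.choice ≠ none} }

/-- A customer moves to the chosen server if it is unassigned or permitted to leave. -/
noncomputable def move (me : ℕ) (x : Cell) (M : Set (ℕ × Cell)) : Cell :=
  open Classical in
  if x.choice ≠ none ∧
      (x.target = none ∨ ∃ j y, (j, y) ∈ M ∧ x.target = some j ∧ y.grant = some me) then
    { x with target := x.choice, moved := True }
  else x

/-- A server recomputes its load, and temporary data are erased. -/
noncomputable def settle (last : Prop) (me : ℕ) (x : Cell) (M : Set (ℕ × Cell)) : Cell :=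
  open Classical in
  { target := x.target
    moved := ¬ last ∧ x.moved
    load := {i | ∃ y, (i, y) ∈ M ∧ y.target = some me}.ncard
    base := if last then {i | ∃ y, (i, y) ∈ M ∧ y.target = some me}.ncard else x.base
    offers := ∅
    request := none
    choice := none
    grant := none }

/-- One communication round of the dynamics. -/
noncomputable def step (layer : ℕ) (first last : Prop) (me : ℕ) (r : Role) (x : Cell)
    (M : Set (ℕ × Cell)) : Cell :=
  match layer with
  | 0 => x.offer first r M
  | 1 => x.ask me M
  | 2 => x.choose me M
  | 3 => x.permit me M
  | 4 => x.move me M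
  | _ => x.settle last me M

end Cell

namespace CustomerServerGraph

variable {V : Type u} (N : CustomerServerGraph V) (ident : V → ℕ)

/-- The local states of the neighbours of `v`, labelled by identifiers. -/
def inbox (x : V → Cell) (v : V) : Set (ℕ × Cell) :=
  (fun w => (ident w, x w)) '' N.graph.neighborSet v

theorem mem_inbox {x : V → Cell} {v : V} {i : ℕ} {y : Cell} :
    (i, y) ∈ N.inbox ident x v ↔ ∃ w, N.graph.Adj v w ∧ ident w = i ∧ x w = y := by
  simp [inbox]

/-- One communication round, applied to the whole network. -/
noncomputable def sweep (layer : ℕ) (first last : Prop) (x : V → Cell) (v : V) : Cell :=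
  Cell.step layer first last (ident v) (N.role v) (x v) (N.inbox ident x v)

/-- Six communication rounds, which make up one round of token dropping. -/
noncomputable def macroRound (first last : Prop) (x : V → Cell) : V → Cell :=
  N.sweep ident 5 first last (N.sweep ident 4 first last (N.sweep ident 3 first last
    (N.sweep ident 2 first last (N.sweep ident 1 first last (N.sweep ident 0 first last x)))))

/-- In the configuration `x` the customer `c` is willing to move to the server `s`. -/
def Offers (first : Prop) (x : V → Cell) (c s : V) : Prop :=
  N.role c = Role.customer ∧ N.graph.Adj c s ∧
    ((first ∧ (x c).target = none ∧ ∀ s', N.graph.Adj c s' → (x s).load ≤ (x s').load) ∨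
      (¬ first ∧ ¬ (x c).moved ∧ ∃ p, N.graph.Adj c p ∧ (x c).target = some (ident p) ∧
        (x p).base < (x p).load ∧ (x s).base + 1 = (x p).base ∧ (x s).load ≤ (x s).base))

/-- The number of customers at `s`, in terms of identifiers. -/
noncomputable def count (x : V → Cell) (s : V) : ℕ :=
  {c | N.graph.Adj s c ∧ (x c).target = some (ident s)}.ncard

/-- A specification of one round of token dropping from the configuration `x` to the
configuration `y`: `req s c` means that the server `s` requests the customer `c`, and `go c s`
that the customer `c` moves to the server `s`. -/
structure IsRound (first last : Prop) (x y : V → Cell) (req go : V → V → Prop) : Prop where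
  offers_of_req : ∀ ⦃s c⦄, req s c → N.Offers ident first x c s
  req_unique : ∀ ⦃s c c'⦄, req s c → req s c' → c = c'
  exists_req : ∀ ⦃c s⦄, N.Offers ident first x c s → ∃ c', req s c'
  req_of_go : ∀ ⦃c s⦄, go c s → req s c
  go_unique : ∀ ⦃c s s'⦄, go c s → go c s' → s = s'
  leave_unique : ∀ ⦃c s c' s'⦄, go c s → go c' s' → (x c).target = (x c').target →
    (x c).target ≠ none → c = c'
  go_of_free : ∀ ⦃s c⦄, req s c → (x c).target = none → ∃ s', go c s'
  exists_go : ∀ ⦃s c⦄, req s c → ∃ c' s', go c' s' ∧ (x c').target = (x c).target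
  target_go : ∀ ⦃c s⦄, go c s → (y c).target = some (ident s)
  target_stay : ∀ ⦃c⦄, (∀ s, ¬ go c s) → (y c).target = (x c).target
  moved_iff : ∀ c, (y c).moved ↔ ¬ last ∧ ((x c).moved ∨ ∃ s, go c s)
  load_eq : ∀ s, (y s).load = N.count ident y s
  base_last : last → ∀ s, (y s).base = (y s).load
  base_not_last : ¬ last → ∀ s, (y s).base = (x s).base

variable {N ident}

theorem ncard_inbox (hi : Function.Injective ident) (x : V → Cell) (s : V) :
    {i | ∃ y, (i, y) ∈ N.inbox ident x s ∧ y.target = some (ident s)}.ncard =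
      N.count ident x s := by
  rw [count, ← Set.ncard_image_of_injective _ hi]
  congr 1
  ext i
  simp only [mem_inbox, Set.mem_ofPred_eq, Set.mem_image]
  constructor
  · rintro ⟨y, ⟨w, h1, h2, h3⟩, h4⟩
    exact ⟨w, ⟨h1, h3 ▸ h4⟩, h2⟩
  · rintro ⟨w, ⟨h1, h4⟩, h2⟩
    exact ⟨_, ⟨w, h1, h2, rfl⟩, h4⟩

/-- This isolates the message passing: the analysis of a phase uses only the properties in
`IsRound`. The relations are read off from the requests and choices in the intermediate
configurations. -/
theorem exists_isRound (hi : Function.Injective ident) (first last : Prop) (x : V → Cell) :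
    ∃ req go, N.IsRound ident first last x (N.macroRound ident first last x) req go := by
  set x1 := N.sweep ident 0 first last x
  set x2 := N.sweep ident 1 first last x1
  set x3 := N.sweep ident 2 first last x2
  set x4 := N.sweep ident 3 first last x3
  set x5 := N.sweep ident 4 first last x4
  have e1 : ∀ v, x1 v = (x v).offer first (N.role v) (N.inbox ident x v) := fun _ => rfl
  have e2 : ∀ v, x2 v = (x1 v).ask (ident v) (N.inbox ident x1 v) := fun _ => rfl
  have e3 : ∀ v, x3 v = (x2 v).choose (ident v) (N.inbox ident x2 v) := fun _ => rfl
  have e4 : ∀ v, x4 v = (x3 v).permit (ident v) (N.inbox ident x3 v) := fun _ => rfl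
  have e5 : ∀ v, x5 v = (x4 v).move (ident v) (N.inbox ident x4 v) := fun _ => rfl
  have e6 : ∀ v, N.macroRound ident first last x v =
    (x5 v).settle last (ident v) (N.inbox ident x5 v) := fun _ => rfl
  have t1 : ∀ v, (x1 v).target = (x v).target := fun _ => rfl
  have t3 : ∀ v, (x3 v).target = (x v).target := fun _ => rfl
  have t4 : ∀ v, (x4 v).target = (x v).target := fun _ => rfl
  have m4 : ∀ v, (x4 v).moved = (x v).moved := fun _ => rfl
  have c4 : ∀ v, (x4 v).choice = (x3 v).choice := fun _ => rfl
  have off : ∀ c s, (N.graph.Adj c s ∧ ident s ∈ (x1 c).offers) ↔ N.Offers ident first x c s := by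
    intro c s
    simp only [e1, Cell.offer, Set.mem_ofPred_eq, mem_inbox, Offers]
    constructor
    · rintro ⟨ha, hr, y, ⟨w, hw, hws, rfl⟩, h⟩
      obtain rfl := hi hws
      refine ⟨hr, hw, h.imp ?_ ?_⟩
      · rintro ⟨h1, h2, h3⟩
        exact ⟨h1, h2, fun s' hs' => h3 _ _ ⟨s', hs', rfl, rfl⟩⟩
      · rintro ⟨h1, h2, i, z, ⟨p, hp, rfl, rfl⟩, h3⟩
        exact ⟨h1, h2, p, hp, h3⟩
    · rintro ⟨hr, ha, h⟩
      refine ⟨ha, hr, _, ⟨s, ha, rfl, rfl⟩, h.imp ?_ ?_⟩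
      · rintro ⟨h1, h2, h3⟩
        refine ⟨h1, h2, ?_⟩
        rintro k z ⟨w, hw, rfl, rfl⟩
        exact h3 w hw
      · rintro ⟨h1, h2, p, hp, h3⟩
        exact ⟨h1, h2, _, _, ⟨p, hp, rfl, rfl⟩, h3⟩
  have req_iff : ∀ s i, (x2 s).request = some i →
      ∃ c, ident c = i ∧ N.Offers ident first x c s := by
    intro s i h
    obtain ⟨y, hy1, hy2⟩ := mem_of_leastElement (s := {i | ∃ y, (i, y) ∈ N.inbox ident x1 s ∧
      ident s ∈ y.offers}) h
    obtain ⟨w, hw, rfl, rfl⟩ := (N.mem_inbox ident).1 hy1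
    exact ⟨w, rfl, (off _ _).1 ⟨hw.symm, hy2⟩⟩
  have choice_iff : ∀ c j, (x3 c).choice = some j →
      ∃ s, ident s = j ∧ (x2 s).request = some (ident c) := by
    intro c j h
    obtain ⟨y, hy1, hy2⟩ := mem_of_leastElement (s := {j | ∃ y, (j, y) ∈ N.inbox ident x2 c ∧
      y.request = some (ident c)}) h
    obtain ⟨w, hw, rfl, rfl⟩ := (N.mem_inbox ident).1 hy1
    exact ⟨w, rfl, hy2⟩
  have exists_choice : ∀ c s, (x2 s).request = some (ident c) → ∃ j, (x3 c).choice = some j := by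
    intro c s h
    obtain ⟨c', hc', ho⟩ := req_iff s _ h
    obtain rfl := hi hc'
    exact exists_leastElement (s := {j | ∃ y, (j, y) ∈ N.inbox ident x2 c' ∧
      y.request = some (ident c')}) ⟨x2 s, (N.mem_inbox ident).2 ⟨s, ho.2.1, rfl, rfl⟩, h⟩
  have grant_iff : ∀ p i, (x4 p).grant = some i →
      ∃ c, ident c = i ∧ N.graph.Adj p c ∧ (x c).target = some (ident p) ∧
        (x3 c).choice ≠ none := by
    intro p i h
    obtain ⟨y, hy1, hy2, hy3⟩ := mem_of_leastElement (s := {i | ∃ y, (i, y) ∈ N.inbox ident x3 p ∧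
      y.target = some (ident p) ∧ y.choice ≠ none}) h
    obtain ⟨w, hw, rfl, rfl⟩ := (N.mem_inbox ident).1 hy1
    exact ⟨w, rfl, hw, hy2, hy3⟩
  have exists_grant : ∀ p c, N.graph.Adj p c → (x c).target = some (ident p) →
      (x3 c).choice ≠ none → ∃ i, (x4 p).grant = some i := by
    intro p c h1 h2 h3
    exact exists_leastElement (s := {i | ∃ y, (i, y) ∈ N.inbox ident x3 p ∧
      y.target = some (ident p) ∧ y.choice ≠ none}) (a := ident c)
      ⟨x3 c, (N.mem_inbox ident).2 ⟨c, h1, rfl, rfl⟩, h2, h3⟩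
  let ok : V → Prop := fun c => (x c).target = none ∨
    ∃ p, N.graph.Adj c p ∧ (x c).target = some (ident p) ∧ (x4 p).grant = some (ident c)
  have ok_iff : ∀ c, ok c ↔ ((x4 c).target = none ∨ ∃ j y, (j, y) ∈ N.inbox ident x4 c ∧
      (x4 c).target = some j ∧ y.grant = some (ident c)) := by
    intro c
    simp only [ok, t4, mem_inbox]
    refine or_congr Iff.rfl ⟨?_, ?_⟩
    · rintro ⟨p, h1, h2, h3⟩
      exact ⟨_, _, ⟨p, h1, rfl, rfl⟩, h2, h3⟩
    · rintro ⟨_, _, ⟨p, h1, rfl, rfl⟩, h2, h3⟩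
      exact ⟨p, h1, h2, h3⟩
  have move_pos : ∀ c s, (x3 c).choice = some (ident s) → ok c →
      (x5 c).target = some (ident s) ∧ (x5 c).moved := by
    intro c s h1 h2
    have : (x4 c).choice ≠ none := by rw [c4, h1]; simp
    rw [e5, Cell.move, if_pos ⟨this, (ok_iff c).1 h2⟩]
    exact ⟨by rw [← h1, ← c4], trivial⟩
  have move_neg : ∀ c, ¬ ((x3 c).choice ≠ none ∧ ok c) →
      (x5 c).target = (x c).target ∧ (x5 c).moved = (x c).moved := by
    intro c h
    rw [e5, Cell.move, if_neg (by rwa [c4, ← ok_iff])]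
    exact ⟨t4 c, m4 c⟩
  refine ⟨fun s c => (x2 s).request = some (ident c),
    fun c s => (x3 c).choice = some (ident s) ∧ ok c, ?_⟩
  have not_go : ∀ c, (∀ s, ¬ ((x3 c).choice = some (ident s) ∧ ok c)) →
      ¬ ((x3 c).choice ≠ none ∧ ok c) := by
    rintro c h ⟨h1, h2⟩
    obtain ⟨j, hj⟩ := Option.ne_none_iff_exists'.1 h1
    obtain ⟨s, rfl, -⟩ := choice_iff c j hj
    exact h s ⟨hj, h2⟩
  constructor
  · intro s c h
    obtain ⟨c', hc', ho⟩ := req_iff s _ h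
    exact hi hc' ▸ ho
  · intro s c c' h h'
    exact hi (Option.some.inj (h.symm.trans h'))
  · intro c s h
    obtain ⟨b, hb⟩ := exists_leastElement (s := {i | ∃ y, (i, y) ∈ N.inbox ident x1 s ∧
      ident s ∈ y.offers}) (a := ident c)
      ⟨x1 c, (N.mem_inbox ident).2 ⟨c, h.2.1.symm, rfl, rfl⟩, ((off _ _).2 h).2⟩
    obtain ⟨c', rfl, -⟩ := req_iff s b hb
    exact ⟨c', hb⟩
  · rintro c s ⟨h, -⟩
    obtain ⟨s', hs', h'⟩ := choice_iff _ _ h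
    exact hi hs' ▸ h'
  · rintro c s s' ⟨h, -⟩ ⟨h', -⟩
    exact hi (Option.some.inj (h.symm.trans h'))
  · rintro c s c' s' ⟨-, h⟩ ⟨-, h'⟩ he hn
    obtain ⟨p, -, hp, hg⟩ := h.resolve_left hn
    obtain ⟨p', -, hp', hg'⟩ := h'.resolve_left (he ▸ hn)
    obtain rfl : p = p' := hi (Option.some.inj (hp.symm.trans (he.trans hp')))
    exact hi (Option.some.inj (hg.symm.trans hg'))
  · intro s c h hn
    obtain ⟨j, hj⟩ := exists_choice c s h
    obtain ⟨s', rfl, -⟩ := choice_iff c j hj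
    exact ⟨s', hj, Or.inl hn⟩
  · intro s c h
    obtain ⟨j, hj⟩ := exists_choice c s h
    obtain ⟨s', rfl, -⟩ := choice_iff c j hj
    obtain ⟨c', hc', ho⟩ := req_iff s _ h
    obtain rfl := hi hc'
    rcases ho.2.2 with ⟨-, hn, -⟩ | ⟨-, -, p, hp, hcp, -⟩
    · exact ⟨c', s', ⟨hj, Or.inl hn⟩, rfl⟩
    -- The server `p` grants only to customers that already have a destination, and `c'` is one of
    -- them. So some grant is made and is used, though perhaps by another customer of `p`.
    · obtain ⟨i, hg⟩ := exists_grant p c' hp.symm hcp (by rw [hj]; simp)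
      obtain ⟨c2, rfl, ha, ht, hc⟩ := grant_iff p i hg
      obtain ⟨j2, hj2⟩ := Option.ne_none_iff_exists'.1 hc
      obtain ⟨s2, rfl, -⟩ := choice_iff c2 j2 hj2
      exact ⟨c2, s2, ⟨hj2, Or.inr ⟨p, ha.symm, ht, hg⟩⟩, ht.trans hcp.symm⟩
  · rintro c s ⟨h1, h2⟩
    exact (move_pos c s h1 h2).1
  · intro c h
    exact (move_neg c (not_go c h)).1
  · intro c
    change (¬ last ∧ (x5 c).moved) ↔ _
    refine and_congr_right fun _ => ?_
    by_cases h : ∃ s, (x3 c).choice = some (ident s) ∧ ok c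
    · obtain ⟨s, h1, h2⟩ := h
      exact ⟨fun _ => Or.inr ⟨s, h1, h2⟩, fun _ => (move_pos c s h1 h2).2⟩
    · rw [(move_neg c (not_go c (not_exists.1 h))).2]
      simp only [h, or_false]
  · intro s
    exact ncard_inbox hi x5 s
  · intro h s
    exact if_pos h
  · intro h s
    have h5 : (x5 s).base = (x s).base := by
      rw [e5, Cell.move]
      split_ifs <;> rfl
    exact (if_neg h).trans h5

end CustomerServerGraph

/-! ### Token dropping within one phase and its termination -/

namespace CustomerServerGraph

variable {V : Type u} (N : CustomerServerGraph V) (ident : V → ℕ)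

/-- The node `w` is within distance `k` of `v`. -/
def Near (k : ℕ) (v w : V) : Prop := ∃ p : N.graph.Walk v w, p.length ≤ k

/-- All servers within distance `k` of `v` have degree at most `S`. -/
def ServerDegreeLE (S k : ℕ) (v : V) : Prop :=
  ∀ w, N.Near k v w → N.role w = Role.server → (N.graph.neighborSet w).ncard ≤ S

/-- A phase of token dropping: `L` rounds, of which only the first one assigns customers that had
not been assigned. -/
structure IsPhase (L : ℕ) (x : ℕ → V → Cell) (req go : ℕ → V → V → Prop) : Prop where
  round : ∀ j < L, N.IsRound ident (j = 0) (j + 1 = L) (x j) (x (j + 1)) (req j) (go j)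
  load_zero : ∀ s, (x 0 s).load = N.count ident (x 0) s
  base_zero : ∀ s, (x 0 s).base = (x 0 s).load
  moved_zero : ∀ c, ¬ (x 0 c).moved
  adj_zero : ∀ c i, (x 0 c).target = some i →
    N.role c = Role.customer ∧ ∃ s, N.graph.Adj c s ∧ ident s = i

/-- In the `j`-th configuration of a phase the server `s` holds a token. -/
def HasToken (x : ℕ → V → Cell) (j : ℕ) (s : V) : Prop := (x 0 s).load < (x j s).load

variable {N ident}

theorem Near.refl (k : ℕ) (v : V) : N.Near k v v := ⟨.nil, Nat.zero_le _⟩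

theorem Near.trans {k l : ℕ} {u v w : V} (h : N.Near k u v) (h' : N.Near l v w) :
    N.Near (k + l) u w := by
  obtain ⟨p, hp⟩ := h
  obtain ⟨q, hq⟩ := h'
  exact ⟨p.append q, by rw [SimpleGraph.Walk.length_append]; omega⟩

theorem Near.mono {k l : ℕ} {u v : V} (h : N.Near k u v) (hkl : k ≤ l) : N.Near l u v :=
  let ⟨p, hp⟩ := h; ⟨p, hp.trans hkl⟩

theorem Near.of_adj {u v : V} (h : N.graph.Adj u v) : N.Near 1 u v := ⟨h.toWalk, by simp⟩

theorem Near.of_adj_adj {u v w : V} (h : N.graph.Adj u v) (h' : N.graph.Adj v w) :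
    N.Near 2 u w := (Near.of_adj h).trans (Near.of_adj h')

theorem ServerDegreeLE.of_near {S k l m : ℕ} {v w : V} (h : N.ServerDegreeLE S m v)
    (hw : N.Near k v w) (hm : k + l ≤ m) : N.ServerDegreeLE S l w :=
  fun a ha hr => h a ((hw.trans ha).mono hm) hr

theorem ServerDegreeLE.mono {S k l : ℕ} {v : V} (h : N.ServerDegreeLE S k v) (hl : l ≤ k) :
    N.ServerDegreeLE S l v := h.of_near (Near.refl 0 v) (by omega)

theorem ServerDegreeLE.self {S k : ℕ} {v : V} (h : N.ServerDegreeLE S k v)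
    (hr : N.role v = Role.server) : (N.graph.neighborSet v).ncard ≤ S := h v (Near.refl _ _) hr

theorem role_server_of_adj {c s : V} (hc : N.role c = Role.customer) (h : N.graph.Adj c s) :
    N.role s = Role.server := by
  have := N.bipartite h
  cases hs : N.role s
  · exact absurd (hc.trans hs.symm) this
  · rfl

theorem count_le_ncard [Finite V] (x : V → Cell) (s : V) :
    N.count ident x s ≤ (N.graph.neighborSet s).ncard :=
  Set.ncard_le_ncard (fun _ h => h.1) (Set.toFinite _)

namespace IsRound

variable {first last : Prop} {x y : V → Cell} {req go : V → V → Prop}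

theorem target_cases (h : N.IsRound ident first last x y req go) (c : V) :
    (∃ s, go c s ∧ (y c).target = some (ident s)) ∨
      (∀ s, ¬ go c s) ∧ (y c).target = (x c).target := by
  by_cases hc : ∃ s, go c s
  · obtain ⟨s, hs⟩ := hc
    exact Or.inl ⟨s, hs, h.target_go hs⟩
  · push Not at hc
    exact Or.inr ⟨hc, h.target_stay hc⟩

theorem offers_of_go (h : N.IsRound ident first last x y req go) {c s : V} (hg : go c s) :
    N.Offers ident first x c s := h.offers_of_req (h.req_of_go hg)

variable [Finite V] (hi : Function.Injective ident)
include hi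

theorem count_le_succ (h : N.IsRound ident first last x y req go) (s : V) :
    N.count ident y s ≤ N.count ident x s + 1 := by
  by_cases hs : ∃ c, go c s
  · obtain ⟨c, hc⟩ := hs
    refine (Set.ncard_le_ncard ?_ (Set.toFinite _)).trans (Set.ncard_insert_le c _)
    rintro d ⟨hd, hd'⟩
    rcases h.target_cases d with ⟨s', hg, ht⟩ | ⟨-, ht⟩
    · obtain rfl : s' = s := hi (Option.some.inj (ht.symm.trans hd'))
      exact Or.inl (h.req_unique (h.req_of_go hg) (h.req_of_go hc))
    · exact Or.inr ⟨hd, ht ▸ hd'⟩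
  · refine (Set.ncard_le_ncard ?_ (Set.toFinite _)).trans (Nat.le_succ _)
    rintro d ⟨hd, hd'⟩
    rcases h.target_cases d with ⟨s', hg, ht⟩ | ⟨-, ht⟩
    · obtain rfl : s' = s := hi (Option.some.inj (ht.symm.trans hd'))
      exact absurd ⟨d, hg⟩ hs
    · exact ⟨hd, ht ▸ hd'⟩

theorem count_le_of_no_go (h : N.IsRound ident first last x y req go) {s : V}
    (hs : ∀ c, ¬ go c s) : N.count ident y s ≤ N.count ident x s := by
  refine Set.ncard_le_ncard ?_ (Set.toFinite _)
  rintro d ⟨hd, hd'⟩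
  rcases h.target_cases d with ⟨s', hg, ht⟩ | ⟨-, ht⟩
  · obtain rfl : s' = s := hi (Option.some.inj (ht.symm.trans hd'))
    exact absurd hg (hs d)
  · exact ⟨hd, ht ▸ hd'⟩

omit hi in
theorem le_count_of_no_leave (h : N.IsRound ident first last x y req go) {s : V}
    (hs : ∀ c t, go c t → (x c).target ≠ some (ident s)) :
    N.count ident x s ≤ N.count ident y s := by
  refine Set.ncard_le_ncard ?_ (Set.toFinite _)
  rintro d ⟨hd, hd'⟩
  rcases h.target_cases d with ⟨s', hg, ht⟩ | ⟨-, ht⟩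
  · exact absurd hd' (hs d s' hg)
  · exact ⟨hd, ht.trans hd'⟩

omit hi in
theorem le_count_succ (h : N.IsRound ident first last x y req go) (s : V) :
    N.count ident x s ≤ N.count ident y s + 1 := by
  by_cases hs : ∃ c t, go c t ∧ (x c).target = some (ident s)
  · obtain ⟨c, t, hc, hcs⟩ := hs
    refine (Set.ncard_le_ncard ?_ (Set.toFinite _)).trans (Set.ncard_insert_le c _)
    rintro d ⟨hd, hd'⟩
    rcases h.target_cases d with ⟨s', hg, ht⟩ | ⟨-, ht⟩
    · exact Or.inl (h.leave_unique hg hc (hd'.trans hcs.symm) (by simp [hd']))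
    · exact Or.inr ⟨hd, ht.trans hd'⟩
  · push Not at hs
    exact (h.le_count_of_no_leave fun c t hg => hs c t hg).trans (Nat.le_succ _)

end IsRound

namespace IsPhase

variable {L : ℕ} {x : ℕ → V → Cell} {req go : ℕ → V → V → Prop}

theorem base_eq (h : N.IsPhase ident L x req go) {j : ℕ} (hj : j < L) (s : V) :
    (x j s).base = (x 0 s).load := by
  induction j with
  | zero => exact h.base_zero s
  | succ j ih =>
    rw [(h.round j (by omega)).base_not_last (by omega), ih (by omega)]

theorem load_eq (h : N.IsPhase ident L x req go) {j : ℕ} (hj : j ≤ L) (s : V) :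
    (x j s).load = N.count ident (x j) s := by
  cases j with
  | zero => exact h.load_zero s
  | succ j => exact (h.round j (by omega)).load_eq s

theorem adj_of_target (h : N.IsPhase ident L x req go) {j : ℕ} (hj : j ≤ L) {c : V} {i : ℕ}
    (hc : (x j c).target = some i) :
    N.role c = Role.customer ∧ ∃ s, N.graph.Adj c s ∧ ident s = i := by
  induction j generalizing i with
  | zero => exact h.adj_zero c i hc
  | succ j ih =>
    have hr := h.round j (by omega)
    rcases hr.target_cases c with ⟨s, hg, ht⟩ | ⟨-, ht⟩
    · have ho := hr.offers_of_go hg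
      exact ⟨ho.1, s, ho.2.1, Option.some.inj (ht.symm.trans hc)⟩
    · exact ih (by omega) (ht ▸ hc)

theorem moved_mono (h : N.IsPhase ident L x req go) {i j : ℕ} (hij : i ≤ j) (hj : j < L) {c : V}
    (hc : (x i c).moved) : (x j c).moved := by
  induction j, hij using Nat.le_induction with
  | base => exact hc
  | succ j hij ih =>
    exact ((h.round j (by omega)).moved_iff c).2 ⟨by omega, Or.inl (ih (by omega))⟩

theorem moved_of_go (h : N.IsPhase ident L x req go) {i j : ℕ} (hij : i < j) (hj : j < L)
    {c s : V} (hc : go i c s) : (x j c).moved :=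
  h.moved_mono hij hj (((h.round i (by omega)).moved_iff c).2 ⟨by omega, Or.inr ⟨s, hc⟩⟩)

theorem target_eq_of_not_moved (h : N.IsPhase ident L x req go) {j : ℕ} (hj : j < L) {c : V}
    (hc : ¬ (x j c).moved) : (x j c).target = (x 0 c).target := by
  induction j with
  | zero => rfl
  | succ j ih =>
    rcases (h.round j (by omega)).target_cases c with ⟨s, hg, -⟩ | ⟨-, ht⟩
    · exact absurd (h.moved_of_go (Nat.lt_succ_self j) hj hg) hc
    · rw [ht, ih (by omega) fun hm => hc (h.moved_mono (Nat.le_succ j) hj hm)]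

theorem offers_iff (h : N.IsPhase ident L x req go) {j : ℕ} (h0 : 0 < j) (hj : j < L) {c s : V} :
    N.Offers ident (j = 0) (x j) c s ↔ N.role c = Role.customer ∧ N.graph.Adj c s ∧
      ¬ (x j c).moved ∧ ∃ p, N.graph.Adj c p ∧ (x j c).target = some (ident p) ∧
        HasToken x j p ∧ (x 0 s).load + 1 = (x 0 p).load ∧ ¬ HasToken x j s := by
  simp only [Offers, h.base_eq hj, h0.ne', false_and, false_or, not_false_eq_true, true_and,
    HasToken, not_lt]

theorem not_moved_of_offers (h : N.IsPhase ident L x req go) {j : ℕ} (hj : j < L) {c s : V}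
    (ho : N.Offers ident (j = 0) (x j) c s) : ¬ (x j c).moved := by
  rcases Nat.eq_zero_or_pos j with rfl | h0
  · exact h.moved_zero c
  · exact ((h.offers_iff h0 hj).1 ho).2.2.1

/-- A customer that is willing to move now was willing to move earlier in the phase, provided that
its server had a token and the other server had none. -/
theorem exists_req_of_offers (h : N.IsPhase ident L x req go) {i j : ℕ} (h0 : 0 < i) (hij : i ≤ j)
    (hj : j < L) {c s p : V} (hi : Function.Injective ident)
    (ho : N.Offers ident (j = 0) (x j) c s) (hp : (x j c).target = some (ident p))
    (hpt : HasToken x i p) (hst : ¬ HasToken x i s) : ∃ c', req i s c' := by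
  obtain ⟨hr, ha, hm, p', hap, htp, -, hl, -⟩ := (h.offers_iff (by omega) hj).1 ho
  obtain rfl : p' = p := hi (Option.some.inj (htp.symm.trans hp))
  have hm' : ¬ (x i c).moved := fun hm' => hm (h.moved_mono hij hj hm')
  refine (h.round i (by omega)).exists_req
    ((h.offers_iff h0 (by omega)).2 ⟨hr, ha, hm', p', hap, ?_, hpt, hl, hst⟩)
  -- A customer that has not moved by round `j` has had the same server since the start of the
  -- phase, in particular in round `i`.
  rw [← hp, h.target_eq_of_not_moved hj hm, h.target_eq_of_not_moved (by omega) hm']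

variable [Finite V] (hi : Function.Injective ident)
include hi

omit hi in
theorem le_load_one (h : N.IsPhase ident L x req go) (hL : 0 < L) (s : V) :
    (x 0 s).load ≤ (x 1 s).load := by
  have hr := h.round 0 hL
  rw [h.load_eq hL.le, h.load_eq hL]
  refine hr.le_count_of_no_leave fun c t hg => ?_
  rcases (hr.offers_of_go hg).2.2 with ⟨-, hn, -⟩ | ⟨hn, -⟩
  · simp [hn]
  · exact absurd rfl hn

/-- A server holds zero or one token: it gains at most one customer per round and, after the first
round, only without a token; it loses at most one, and only with a token. -/
theorem load_bounds (h : N.IsPhase ident L x req go) {j : ℕ} (h0 : 0 < j) (hj : j ≤ L) (s : V) :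
    (x 0 s).load ≤ (x j s).load ∧ (x j s).load ≤ (x 0 s).load + 1 := by
  induction j, h0 using Nat.le_induction with
  | base =>
    refine ⟨h.le_load_one (by omega) s, ?_⟩
    rw [h.load_eq (Nat.zero_le _), h.load_eq hj]
    exact (h.round 0 (by omega)).count_le_succ hi s
  | succ j h0 ih =>
    have hr := h.round j (by omega)
    obtain ⟨ih1, ih2⟩ := ih (by omega)
    rw [h.load_eq (show j ≤ L by omega)] at ih1 ih2
    rw [h.load_eq hj]
    have hup := hr.count_le_succ hi s
    have hdown := hr.le_count_succ s
    by_cases ht : HasToken x j s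
    · have : N.count ident (x (j + 1)) s ≤ N.count ident (x j) s :=
        hr.count_le_of_no_go hi fun c hg =>
          ((h.offers_iff h0 (by omega)).1 (hr.offers_of_go hg)).2.2.2.choose_spec.2.2.2.2 ht
      rw [HasToken, h.load_eq (show j ≤ L by omega)] at ht
      omega
    · have : N.count ident (x j) s ≤ N.count ident (x (j + 1)) s :=
        hr.le_count_of_no_leave fun c t hg hcs => by
          obtain ⟨-, -, -, p, -, hp, hpt, -⟩ := (h.offers_iff h0 (by omega)).1 (hr.offers_of_go hg)
          obtain rfl : p = s := hi (Option.some.inj (hp.symm.trans hcs))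
          exact ht hpt
      rw [HasToken, h.load_eq (show j ≤ L by omega)] at ht
      omega

theorem exists_go_of_gain (h : N.IsPhase ident L x req go) {j : ℕ} (hj : j < L) {s : V}
    (h1 : ¬ HasToken x j s) (h2 : HasToken x (j + 1) s) : ∃ c, go j c s := by
  by_contra! hs
  have := (h.round j hj).count_le_of_no_go hi hs
  have e1 := h.load_eq hj.le s
  have e2 := h.load_eq (j := j + 1) hj s
  rw [HasToken] at h1 h2
  omega

omit hi in
theorem exists_go_of_loss (h : N.IsPhase ident L x req go) {j : ℕ} (hj : j < L) {s : V}
    (h1 : HasToken x j s) (h2 : ¬ HasToken x (j + 1) s) :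
    ∃ c t, go j c t ∧ (x j c).target = some (ident s) := by
  by_contra! hs
  have := (h.round j hj).le_count_of_no_leave hs
  have e1 := h.load_eq hj.le s
  have e2 := h.load_eq (j := j + 1) hj s
  rw [HasToken] at h1 h2
  omega

/-- The servers below `u` that were active while `u` was occupied. -/
theorem exists_finset_below (h : N.IsPhase ident L x req go) {j : ℕ} (hj : j < L) {u : V}
    (hu : ¬ HasToken x j u) : ∃ Y : Finset V, Y.card ≤ (x 0 u).load ∧
      (∀ y ∈ Y, N.Near (2 * (x 0 u).load) u y) ∧
      ∀ i, 0 < i → i ≤ j → ¬ HasToken x i u ∨ ∃ y ∈ Y, ∃ c, req i y c := by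
  classical
  induction j generalizing u with
  | zero => exact ⟨∅, by simp, by simp, fun i _ _ => by omega⟩
  | succ j ih =>
    rcases Nat.eq_zero_or_pos j with rfl | h0
    · refine ⟨∅, by simp, by simp, fun i _ _ => Or.inl ?_⟩
      obtain rfl : i = 0 + 1 := by omega
      exact hu
    by_cases ht : HasToken x j u
    -- Here `u` has just passed its token to `t`, one level lower and unoccupied. In an earlier
    -- round with `u` occupied, either `t` was occupied and the set of `t` was active, or `c` was
    -- already willing to move to `t`, which then made a request. Adding `t` costs one element per
    -- level, whence the bound by the level of `u`.
    · obtain ⟨c, t, hg, hcu⟩ := h.exists_go_of_loss (by omega) ht hu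
      have ho := (h.round j (by omega)).offers_of_go hg
      obtain ⟨-, hct, -, p, hcp, hp, -, hl, htt⟩ := (h.offers_iff h0 (by omega)).1 ho
      obtain rfl : p = u := hi (Option.some.inj (hp.symm.trans hcu))
      obtain ⟨Y, hY1, hY2, hY3⟩ := ih (by omega) htt
      have hn : N.Near 2 p t := Near.of_adj_adj hcp.symm hct
      refine ⟨insert t Y, (Finset.card_insert_le _ _).trans (by omega), ?_, ?_⟩
      · intro y hy
        rcases Finset.mem_insert.1 hy with rfl | hy
        · exact hn.mono (by omega)
        · exact (hn.trans (hY2 y hy)).mono (by omega)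
      · intro i hi0 hij
        by_cases hiu : HasToken x i p
        · refine Or.inr ?_
          rcases Nat.lt_or_ge j i with hji | hji
          · obtain rfl : i = j + 1 := by omega
            exact absurd hiu hu
          by_cases hit : HasToken x i t
          · obtain ⟨y, hy, hc⟩ := (hY3 i hi0 hji).resolve_left (not_not.2 hit)
            exact ⟨y, Finset.mem_insert_of_mem hy, hc⟩
          · exact ⟨t, Finset.mem_insert_self _ _,
              h.exists_req_of_offers hi0 hji (by omega) hi ho hcu hiu hit⟩
        · exact Or.inl hiu
    · obtain ⟨Y, hY1, hY2, hY3⟩ := ih (by omega) ht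
      refine ⟨Y, hY1, hY2, fun i hi0 hij => ?_⟩
      rcases Nat.lt_or_ge j i with hji | hji
      · obtain rfl : i = j + 1 := by omega
        exact Or.inl hu
      · exact hY3 i hi0 hji

omit hi in
theorem load_le (h : N.IsPhase ident L x req go) {j : ℕ} (hj : j ≤ L) {S k : ℕ} {s : V}
    (hd : N.ServerDegreeLE S k s) (hs : N.role s = Role.server) : (x j s).load ≤ S :=
  ((h.load_eq hj s).trans_le (count_le_ncard _ _)).trans (hd.self hs)

/-- The servers above `v` that were active while `v` was not occupied. -/
theorem exists_finset_above (h : N.IsPhase ident L x req go) {S : ℕ} {j : ℕ} (hj : j < L) {n : ℕ}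
    {v : V} (hv : HasToken x j v) (hn : S ≤ n + (x 0 v).load)
    (hd : N.ServerDegreeLE S (2 * n) v) :
    ∃ Y : Finset V, Y.card ≤ n ∧ (∀ y ∈ Y, N.Near (2 * n) v y) ∧
      ∀ i, 0 < i → i ≤ j → HasToken x i v ∨ ∃ y ∈ Y, ∃ c, req i y c := by
  classical
  induction j generalizing v n with
  | zero => exact ⟨∅, by simp, by simp, fun i _ _ => by omega⟩
  | succ j ih =>
    rcases Nat.eq_zero_or_pos j with rfl | h0
    · refine ⟨∅, by simp, by simp, fun i _ _ => Or.inl ?_⟩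
      obtain rfl : i = 0 + 1 := by omega
      exact hv
    by_cases ht : HasToken x j v
    · obtain ⟨Y, hY1, hY2, hY3⟩ := ih (by omega) ht hn hd
      refine ⟨Y, hY1, hY2, fun i hi0 hij => ?_⟩
      rcases Nat.lt_or_ge j i with hji | hji
      · obtain rfl : i = j + 1 := by omega
        exact Or.inl hv
      · exact hY3 i hi0 hji
    -- Dual to the descent: `v` has just received its token from `w`, one level higher, so the
    -- budget `n` decreases as the level rises.
    · obtain ⟨c, hg⟩ := h.exists_go_of_gain hi (by omega) ht hv
      have ho := (h.round j (by omega)).offers_of_go hg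
      obtain ⟨hr, hcv, -, w, hcw, hw, hwt, hl, -⟩ := (h.offers_iff h0 (by omega)).1 ho
      have hload := h.load_le hj.le hd (role_server_of_adj hr hcv)
      have hnw : N.Near 2 v w := Near.of_adj_adj hcv.symm hcw
      rw [HasToken] at hv
      -- The load of `v` with its token is at most `S`, so its level is below `S` and `n` is
      -- positive.
      obtain ⟨m, rfl⟩ : ∃ m, n = m + 1 := ⟨n - 1, by omega⟩
      obtain ⟨Y, hY1, hY2, hY3⟩ := ih (n := m) (by omega) hwt (by omega)
        (hd.of_near hnw (by omega))
      refine ⟨insert v Y, (Finset.card_insert_le _ _).trans (by omega), ?_, ?_⟩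
      · intro y hy
        rcases Finset.mem_insert.1 hy with rfl | hy
        · exact Near.refl _ _
        · exact (hnw.trans (hY2 y hy)).mono (by omega)
      · intro i hi0 hij
        by_cases hiv : HasToken x i v
        · exact Or.inl hiv
        · refine Or.inr ?_
          rcases Nat.lt_or_ge j i with hji | hji
          · obtain rfl : i = j + 1 := by omega
            exact absurd hv hiv
          by_cases hiw : HasToken x i w
          · exact ⟨v, Finset.mem_insert_self _ _,
              h.exists_req_of_offers hi0 hji (by omega) hi ho hw hiw hiv⟩
          · obtain ⟨y, hy, hc⟩ := (hY3 i hi0 hji).resolve_left hiw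
            exact ⟨y, Finset.mem_insert_of_mem hy, hc⟩

/-- A server of a network with server degrees at most `S` requests customers in at most `S ^ 2`
rounds of a phase. -/
theorem ncard_req_le (h : N.IsPhase ident L x req go) {S : ℕ} {y : V}
    (hd : N.ServerDegreeLE S 2 y) : {j | 0 < j ∧ j < L ∧ ∃ c, req j y c}.ncard ≤ S * S := by
  classical
  have := Fintype.ofFinite V
  by_cases hne : ∃ j, 0 < j ∧ j < L ∧ ∃ c, req j y c
  swap
  · push Not at hne
    rw [show {j | 0 < j ∧ j < L ∧ ∃ c, req j y c} = ∅ from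
      Set.eq_empty_of_forall_notMem fun j hj => hj.2.2.elim (hne j hj.1 hj.2.1)]
    simp
  have hy : N.role y = Role.server := by
    obtain ⟨j, h0, hj, c, hc⟩ := hne
    have ho := (h.round j hj).offers_of_req hc
    exact role_server_of_adj ho.1 ho.2.1
  -- The customers that started the phase at the server of some neighbour of `y`: at most `S`
  -- neighbours, each with at most `S` customers at its server. Any request by `y` makes one of them
  -- move, possibly to a server other than `y`.
  let F : Finset V := (N.graph.neighborSet y).toFinset.biUnion fun c =>
    {d | (x 0 d).target = (x 0 c).target ∧ (x 0 c).target ≠ none}.toFinset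
  have hF : F.card ≤ S * S := by
    refine (Finset.card_biUnion_le_card_mul _ _ S ?_).trans (Nat.mul_le_mul_right _ ?_)
    · intro c hc
      rw [Set.mem_toFinset] at hc
      rw [← Set.ncard_eq_toFinset_card']
      cases ht : (x 0 c).target with
      | none => simp
      | some i =>
        obtain ⟨hr, p, hp, rfl⟩ := h.adj_zero c i ht
        refine le_trans (Set.ncard_le_ncard ?_ (Set.toFinite _))
          (hd p (Near.of_adj_adj hc hp) (role_server_of_adj hr hp))
        rintro d ⟨hd', -⟩
        obtain ⟨-, p', hp', he⟩ := h.adj_zero d _ hd'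
        exact hi he ▸ hp'.symm
    · rw [← Set.ncard_eq_toFinset_card']
      exact hd.self hy
  have key : ∀ j, (0 < j ∧ j < L ∧ ∃ c, req j y c) → ∃ d ∈ F, ∃ s, go j d s := by
    rintro j ⟨h0, hj, c, hc⟩
    have hr := h.round j hj
    obtain ⟨d, s, hg, hdt⟩ := hr.exists_go hc
    have hoc := hr.offers_of_req hc
    have hod := hr.offers_of_go hg
    refine ⟨d, ?_, s, hg⟩
    have hcm := h.not_moved_of_offers hj hoc
    have hdm := h.not_moved_of_offers hj hod
    obtain ⟨-, hcy, -, p, -, hp, -⟩ := (h.offers_iff h0 hj).1 hoc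
    rw [h.target_eq_of_not_moved hj hcm, h.target_eq_of_not_moved hj hdm] at hdt
    rw [h.target_eq_of_not_moved hj hcm] at hp
    simp only [F, Finset.mem_biUnion, Set.mem_toFinset]
    exact ⟨c, hcy.symm, hdt, by simp [hp]⟩
  have : Nonempty V := ⟨y⟩
  choose! f hf s hs using key
  refine le_trans ?_ hF
  rw [← Set.ncard_coe_finset F]
  refine Set.ncard_le_ncard_of_injOn f (fun j hj => hf j hj) ?_ (Set.toFinite _)
  -- The mover in an earlier round is marked as moved and cannot move again in this phase, so
  -- different rounds have different movers.
  have aux : ∀ i j, (0 < i ∧ i < L ∧ ∃ c, req i y c) → (0 < j ∧ j < L ∧ ∃ c, req j y c) →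
      i < j → f i ≠ f j := by
    intro i j hi' hj' hij he
    have h1 := h.moved_of_go hij hj'.2.1 (hs i hi')
    rw [he] at h1
    exact h.not_moved_of_offers hj'.2.1 ((h.round j hj'.2.1).offers_of_go (hs j hj')) h1
  intro i hi' j hj' he
  rcases lt_trichotomy i j with hij | hij | hij
  · exact absurd he (aux i j hi' hj' hij)
  · exact hij
  · exact absurd he.symm (aux j i hj' hi' hij)

/-- Token dropping ends after `S ^ 3` rounds. -/
theorem le_of_req (h : N.IsPhase ident L x req go) {S : ℕ} {j : ℕ} (h0 : 0 < j) (hj : j < L)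
    {u c : V} (hr : req j u c) (hd : N.ServerDegreeLE S (2 * S + 2) u) : j ≤ S ^ 3 := by
  classical
  have ho := (h.round j hj).offers_of_req hr
  obtain ⟨hrc, hcu, -, v, hcv, hv, hvt, hl, hut⟩ := (h.offers_iff h0 hj).1 ho
  have huv : N.Near 2 u v := Near.of_adj_adj hcu.symm hcv
  have hvS : (x 0 v).load ≤ S := by
    have := h.load_le hj.le (hd.of_near (l := 0) huv (by omega)) (role_server_of_adj hrc hcv)
    rw [HasToken] at hvt
    omega
  obtain ⟨Y, hY1, hY2, hY3⟩ := h.exists_finset_below hi hj hut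
  obtain ⟨Z, hZ1, hZ2, hZ3⟩ := h.exists_finset_above hi (S := S) (n := S - (x 0 v).load) hj hvt
    (by omega) (hd.of_near huv (by omega))
  -- With `v` one level above `u` and at most at level `S`, the sizes add up to at most `1 + (level
  -- u) + (S - level v) = S`; `hvS` makes the truncated subtraction exact.
  have hW : (insert u (Y ∪ Z)).card ≤ S := by
    have h1 := Finset.card_insert_le u (Y ∪ Z)
    have h2 := Finset.card_union_le Y Z
    omega
  have hnear : ∀ y ∈ insert u (Y ∪ Z), N.Near (2 * S) u y := by
    intro y hy
    rcases Finset.mem_insert.1 hy with rfl | hy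
    · exact Near.refl _ _
    rcases Finset.mem_union.1 hy with hy | hy
    · exact (hY2 y hy).mono (by omega)
    · exact (huv.trans (hZ2 y hy)).mono (by omega)
  have hfin : ∀ y, {i | 0 < i ∧ i < L ∧ ∃ c, req i y c}.Finite := fun y =>
    (Set.finite_lt_nat L).subset fun i hi' => hi'.2.1
  -- If neither chain is active in round `i`, then `u` is free and `v` occupied, so `c` is already
  -- offering itself to `u` and `u` makes a request.
  have hcover : Finset.Ioc 0 j ⊆ (insert u (Y ∪ Z)).biUnion fun y => (hfin y).toFinset := by
    intro i hi'
    obtain ⟨hi0, hij⟩ := Finset.mem_Ioc.1 hi'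
    suffices ∃ y ∈ insert u (Y ∪ Z), ∃ c, req i y c by
      obtain ⟨y, hy, hc⟩ := this
      exact Finset.mem_biUnion.2 ⟨y, hy, (hfin y).mem_toFinset.2 ⟨hi0, by omega, hc⟩⟩
    rcases hY3 i hi0 hij with hiu | ⟨y, hy, hc⟩
    · rcases hZ3 i hi0 hij with hiv | ⟨y, hy, hc⟩
      · exact ⟨u, Finset.mem_insert_self _ _, h.exists_req_of_offers hi0 hij hj hi ho hv hiv hiu⟩
      · exact ⟨y, Finset.mem_insert_of_mem (Finset.mem_union_right _ hy), hc⟩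
    · exact ⟨y, Finset.mem_insert_of_mem (Finset.mem_union_left _ hy), hc⟩
  have h1 := Finset.card_le_card hcover
  have h2 := Finset.card_biUnion_le_card_mul (insert u (Y ∪ Z)) (fun y => (hfin y).toFinset) (S * S)
    (fun y hy => by
      rw [← Set.ncard_eq_toFinset_card _ (hfin y)]
      exact h.ncard_req_le hi (hd.of_near (hnear y hy) le_rfl))
  rw [Nat.card_Ioc] at h1
  calc j = j - 0 := rfl
    _ ≤ (insert u (Y ∪ Z)).card * (S * S) := h1.trans h2
    _ ≤ S * (S * S) := Nat.mul_le_mul_right _ hW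
    _ = S ^ 3 := by ring

end IsPhase

end CustomerServerGraph

/-! ### Effect of a phase: progress, balance and rest -/

namespace CustomerServerGraph

variable {V : Type u} (N : CustomerServerGraph V) (ident : V → ℕ)

/-- No assigned customer can lower the load that it experiences. -/
def IsBalanced (x : V → Cell) : Prop :=
  ∀ c s s', (x c).target = some (ident s) → N.graph.Adj c s' → (x s).load ≤ (x s').load + 1

variable {N ident}

namespace IsPhase

variable {L : ℕ} {x : ℕ → V → Cell} {req go : ℕ → V → V → Prop}

theorem target_ne_none (h : N.IsPhase ident L x req go) {j : ℕ} (hj : j ≤ L) {c : V}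
    (hc : (x 0 c).target ≠ none) : (x j c).target ≠ none := by
  induction j with
  | zero => exact hc
  | succ j ih =>
    rcases (h.round j (by omega)).target_cases c with ⟨s, -, ht⟩ | ⟨-, ht⟩
    · simp [ht]
    · exact ht ▸ ih (by omega)

theorem target_eq_none_of_go_zero (h : N.IsPhase ident L x req go) (hL : 0 < L) {c s : V}
    (hg : go 0 c s) : (x 0 c).target = none ∧ ∀ s', N.graph.Adj c s' →
      (x 0 s).load ≤ (x 0 s').load := by
  rcases ((h.round 0 hL).offers_of_go hg).2.2 with ⟨-, h'⟩ | ⟨hn, -⟩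
  · exact h'
  · exact absurd rfl hn

variable [Finite V]

/-- If a customer is unassigned at the start of a phase, then some customer at distance at most
two becomes assigned. -/
theorem exists_assigned (h : N.IsPhase ident L x req go) (hL : 0 < L) {c : V}
    (hr : N.role c = Role.customer) (hc : (x 0 c).target = none) (hs : ∃ s, N.graph.Adj c s) :
    ∃ s d, N.graph.Adj c s ∧ N.graph.Adj s d ∧ (x 0 d).target = none ∧
      (x L d).target ≠ none := by
  obtain ⟨s, hs, hmin⟩ := Set.exists_min_image {s | N.graph.Adj c s} (fun s => (x 0 s).load)
    (Set.toFinite _) hs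
  have hr0 := h.round 0 hL
  obtain ⟨d, hd⟩ := hr0.exists_req (c := c) (s := s) ⟨hr, hs, Or.inl ⟨rfl, hc, hmin⟩⟩
  have ho := hr0.offers_of_req hd
  have hdn : (x 0 d).target = none := by
    rcases ho.2.2 with ⟨-, h', -⟩ | ⟨hn, -⟩
    · exact h'
    · exact absurd rfl hn
  obtain ⟨t, ht⟩ := hr0.go_of_free hd hdn
  refine ⟨s, d, hs, ho.2.1.symm, hdn, ?_⟩
  have h1 : (x 1 d).target ≠ none := by
    rw [hr0.target_go ht]
    simp
  have : ∀ j, 1 ≤ j → j ≤ L → (x j d).target ≠ none := by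
    intro j h1j
    induction j, h1j using Nat.le_induction with
    | base => exact fun _ => h1
    | succ j h1j ih =>
      intro hj
      rcases (h.round j (by omega)).target_cases d with ⟨s, -, ht⟩ | ⟨-, ht⟩
      · simp [ht]
      · exact ht ▸ ih (by omega)
  exact this L hL le_rfl

variable (hi : Function.Injective ident)
include hi

omit [Finite V] in
-- A customer assigned in the first round picks a server of least level. A later move goes one level
-- down from a server that the balance at the start put at most one level above every alternative.
-- Either way its token, if any, costs at most the permitted excess of one.
theorem base_le_of_moved (h : N.IsPhase ident L x req go) (hb : N.IsBalanced ident (x 0)) {j : ℕ}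
    (hj : j < L) {c s s' : V} (hm : (x j c).moved) (hc : (x j c).target = some (ident s))
    (hs : N.graph.Adj c s') : (x 0 s).load ≤ (x 0 s').load := by
  induction j with
  | zero => exact absurd hm (h.moved_zero c)
  | succ j ih =>
    have hr := h.round j (by omega)
    rcases hr.target_cases c with ⟨t, hg, ht⟩ | ⟨hg, ht⟩
    · obtain rfl : t = s := hi (Option.some.inj (ht.symm.trans hc))
      rcases Nat.eq_zero_or_pos j with rfl | h0
      · exact (h.target_eq_none_of_go_zero (by omega) hg).2 s' hs
      · obtain ⟨-, -, hn, p, -, hp, -, hl, -⟩ := (h.offers_iff h0 (by omega)).1 (hr.offers_of_go hg)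
        rw [h.target_eq_of_not_moved (by omega) hn] at hp
        have := hb c p s' hp hs
        omega
    · refine ih (by omega) ?_ (ht ▸ hc)
      exact ((hr.moved_iff c).1 hm).2.resolve_right fun ⟨s, hs⟩ => hg s hs

/-- A phase that is long enough ends with a balanced configuration. -/
theorem isBalanced (h : N.IsPhase ident L x req go) {S : ℕ} (hL : S ^ 3 + 2 ≤ L)
    (hS : ∀ v, N.ServerDegreeLE S (2 * S + 2) v) (hb : N.IsBalanced ident (x 0)) :
    N.IsBalanced ident (x L) := by
  obtain ⟨j, rfl⟩ : ∃ j, L = j + 1 := ⟨L - 1, by omega⟩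
  have hr := h.round j (by omega)
  -- The last round has index `L - 1 > S ^ 3`, so there are no requests in it and it leaves targets
  -- and loads unchanged.
  have hno : ∀ s c, ¬ req j s c := fun s c hc => by
    have := h.le_of_req hi (by omega) (by omega) hc (hS s)
    omega
  have ht : ∀ c, (x (j + 1) c).target = (x j c).target := fun c =>
    hr.target_stay fun s hg => hno s c (hr.req_of_go hg)
  have hload : ∀ s, (x (j + 1) s).load = (x j s).load := fun s => by
    rw [h.load_eq le_rfl, h.load_eq (Nat.le_succ j)]
    simp only [count, ht]
  intro c s s' hc hs'
  rw [hload, hload]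
  rw [ht] at hc
  obtain ⟨b1, b2⟩ := h.load_bounds hi (j := j) (by omega) (by omega) s
  obtain ⟨b1', b2'⟩ := h.load_bounds hi (j := j) (by omega) (by omega) s'
  by_cases hm : (x j c).moved
  · have := h.base_le_of_moved hi hb (by omega) hm hc hs'
    omega
  · obtain ⟨hrole, t, hct, hts⟩ := h.adj_of_target (Nat.le_succ j) hc
    obtain rfl := hi hts
    have hbs := hb c t s' (by rw [← h.target_eq_of_not_moved (by omega) hm, hc]) hs'
    -- A violation forces the levels to differ by exactly one, with a token on `t` and none on `s'`.
    -- Then `c` would offer itself to `s'`, and `s'` would make a request.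
    by_contra hlt
    have : N.Offers ident (j = 0) (x j) c s' :=
      (h.offers_iff (by omega) (by omega)).2 ⟨hrole, hs', hm, t, hct, hc,
        by rw [HasToken]; omega, by omega, by rw [HasToken]; omega⟩
    obtain ⟨d, hd⟩ := hr.exists_req this
    exact hno _ _ hd

/-- Tracing a token back in time leads up one level per move, hence at most `n` times, to the
unassigned customer that created it in the first round. This makes the activity of a phase local. -/
theorem exists_free_of_hasToken (h : N.IsPhase ident L x req go) {S n j : ℕ} (h0 : 0 < j)
    (hj : j < L) {v : V} (hv : HasToken x j v) (hn : S ≤ n + (x 0 v).load)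
    (hd : N.ServerDegreeLE S (2 * n) v) :
    ∃ c, N.Near (2 * n + 1) v c ∧ N.role c = Role.customer ∧ (x 0 c).target = none := by
  induction j, h0 using Nat.le_induction generalizing v n with
  | base =>
    obtain ⟨c, hg⟩ := h.exists_go_of_gain hi (by omega) (lt_irrefl _) hv
    have ho := (h.round 0 (by omega)).offers_of_go hg
    exact ⟨c, (Near.of_adj ho.2.1.symm).mono (by omega), ho.1,
      (h.target_eq_none_of_go_zero (by omega) hg).1⟩
  | succ j h0 ih =>
    by_cases ht : HasToken x j v
    · exact ih (by omega) ht hn hd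
    · obtain ⟨c, hg⟩ := h.exists_go_of_gain hi (by omega) ht hv
      have ho := (h.round j (by omega)).offers_of_go hg
      obtain ⟨hr, hcv, -, w, hcw, hw, hwt, hl, -⟩ := (h.offers_iff h0 (by omega)).1 ho
      have hload := h.load_le hj.le hd (role_server_of_adj hr hcv)
      have hnw : N.Near 2 v w := Near.of_adj_adj hcv.symm hcw
      rw [HasToken] at hv
      obtain ⟨m, rfl⟩ : ∃ m, n = m + 1 := ⟨n - 1, by omega⟩
      obtain ⟨d, hd1, hd2⟩ := ih (n := m) (by omega) hwt (by omega) (hd.of_near hnw (by omega))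
      exact ⟨d, (hnw.trans hd1).mono (by omega), hd2⟩

/-- A customer does not move if all customers in the vicinity are assigned. -/
theorem target_eq_of_assigned (h : N.IsPhase ident L x req go) {S : ℕ} {c : V}
    (hd : N.ServerDegreeLE S (2 * S + 1) c)
    (ha : ∀ d, N.Near (2 * S + 2) c d → N.role d = Role.customer → (x 0 d).target ≠ none)
    {j : ℕ} (hj : j ≤ L) : (x j c).target = (x 0 c).target := by
  induction j with
  | zero => rfl
  | succ j ih =>
    have hr := h.round j (by omega)
    refine (hr.target_stay fun s hg => ?_).trans (ih (by omega))
    have ho := hr.offers_of_go hg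
    rcases Nat.eq_zero_or_pos j with rfl | h0
    · exact ha c (Near.refl _ _) ho.1 (h.target_eq_none_of_go_zero (by omega) hg).1
    · obtain ⟨-, -, -, p, hcp, -, hp, -⟩ := (h.offers_iff h0 (by omega)).1 ho
      have hn : N.Near 1 c p := Near.of_adj hcp
      obtain ⟨d, hd1, hd2, hd3⟩ := h.exists_free_of_hasToken hi (S := S) (n := S) h0 (by omega) hp
        (by omega) (hd.of_near hn (by omega))
      exact ha d ((hn.trans hd1).mono (by omega)) hd2 hd3

end IsPhase

end CustomerServerGraph

/-! ### The sequence of phases and independence of the phase length -/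

namespace CustomerServerGraph

variable {V : Type u} (N : CustomerServerGraph V) (ident : V → ℕ)

/-- The local states after `t` communication rounds of the dynamics with phases that consist of
`L` rounds of token dropping. -/
noncomputable def trace (L : ℕ) : ℕ → V → Cell
  | 0 => fun _ => Cell.init
  | t + 1 => N.sweep ident (t % 6) (t / 6 % L = 0) ((t / 6 + 1) % L = 0) (trace L t)

theorem trace_macroRound (L m : ℕ) : N.trace ident L (6 * (m + 1)) =
    N.macroRound ident (m % L = 0) ((m + 1) % L = 0) (N.trace ident L (6 * m)) := by
  have h : ∀ i < 6, N.trace ident L (6 * m + i + 1) =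
      N.sweep ident i (m % L = 0) ((m + 1) % L = 0) (N.trace ident L (6 * m + i)) := by
    intro i hi
    rw [trace, show (6 * m + i) % 6 = i by omega, show (6 * m + i) / 6 = m by omega]
  rw [show 6 * (m + 1) = 6 * m + 5 + 1 by ring, h 5 (by omega), h 4 (by omega), h 3 (by omega),
    h 2 (by omega), h 1 (by omega), h 0 (by omega)]
  rfl

/-- The `j`-th configuration of the phase number `p`. -/
noncomputable def phaseState (L p j : ℕ) : V → Cell := N.trace ident L (6 * (L * p + j))

variable {N ident}

theorem phaseState_length (L p : ℕ) :
    N.phaseState ident L p L = N.phaseState ident L (p + 1) 0 := by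
  rw [phaseState, phaseState]
  ring_nf

theorem phaseState_succ {L p j : ℕ} (hj : j < L) : N.phaseState ident L p (j + 1) =
    N.macroRound ident (j = 0) (j + 1 = L) (N.phaseState ident L p j) := by
  have h1 : ((L * p + j) % L = 0) = (j = 0) := by
    rw [Nat.mul_add_mod, Nat.mod_eq_of_lt hj]
  have h2 : ((L * p + j + 1) % L = 0) = (j + 1 = L) := by
    rw [add_assoc, Nat.mul_add_mod]
    rcases Nat.lt_or_ge (j + 1) L with h | h
    · rw [Nat.mod_eq_of_lt h]
      exact propext (by omega)
    · obtain rfl : L = j + 1 := by omega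
      simp
  rw [phaseState, ← add_assoc, trace_macroRound, h1, h2]
  rfl

theorem exists_isPhase (hi : Function.Injective ident) {L : ℕ} (hL : 0 < L) (p : ℕ) :
    ∃ req go, N.IsPhase ident L (N.phaseState ident L p) req go := by
  have hround : ∀ q j, ∃ req go, j < L → N.IsRound ident (j = 0) (j + 1 = L)
      (N.phaseState ident L q j) (N.phaseState ident L q (j + 1)) req go := by
    intro q j
    obtain ⟨req, go, h⟩ := exists_isRound (N := N) hi (j = 0) (j + 1 = L) (N.phaseState ident L q j)
    exact ⟨req, go, fun hj => phaseState_succ (N := N) (ident := ident) hj ▸ h⟩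
  induction p with
  | zero =>
    choose req go h using hround 0
    have h0 : ∀ v, N.phaseState ident L 0 0 v = Cell.init := fun _ => rfl
    refine ⟨req, go, h, ?_, ?_, ?_, ?_⟩
    · intro s
      simp [count, h0, Cell.init]
    · simp [h0, Cell.init]
    · simp [h0, Cell.init]
    · simp [h0, Cell.init]
  | succ p ih =>
    choose req go h using hround (p + 1)
    obtain ⟨req', go', h'⟩ := ih
    obtain ⟨j, rfl⟩ : ∃ j, L = j + 1 := ⟨L - 1, by omega⟩
    have hr := h'.round j (by omega)
    refine ⟨req, go, h, ?_, ?_, ?_, ?_⟩ <;> rw [← phaseState_length]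
    · exact hr.load_eq
    · exact hr.base_last rfl
    · exact fun c hc => ((hr.moved_iff c).1 hc).1 rfl
    · exact fun c i hc => h'.adj_of_target le_rfl hc

theorem target_ne_none_of_le (hi : Function.Injective ident) {L : ℕ} (hL : 0 < L) {p q : ℕ}
    (hpq : p ≤ q) {c : V} (hc : (N.phaseState ident L p 0 c).target ≠ none) :
    (N.phaseState ident L q 0 c).target ≠ none := by
  induction q, hpq using Nat.le_induction with
  | base => exact hc
  | succ q hpq ih =>
    obtain ⟨req, go, h⟩ := exists_isPhase (N := N) hi hL q
    rw [← phaseState_length]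
    exact h.target_ne_none le_rfl ih

theorem sweep_congr {layer : ℕ} {first last : Prop} {x y : V → Cell} {v : V}
    (h : ∀ w, N.Near 1 v w → x w = y w) :
    N.sweep ident layer first last x v = N.sweep ident layer first last y v := by
  have : N.inbox ident x v = N.inbox ident y v :=
    Set.image_congr fun w hw => by rw [h w (Near.of_adj hw)]
  rw [sweep, sweep, this, h v (Near.refl _ _)]

theorem macroRound_congr {first last : Prop} {x y : V → Cell} {v : V}
    (h : ∀ w, N.Near 6 v w → x w = y w) :
    N.macroRound ident first last x v = N.macroRound ident first last y v := by
  have step : ∀ (k layer : ℕ) (x y : V → Cell), (∀ w, N.Near (k + 1) v w → x w = y w) →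
      ∀ w, N.Near k v w →
        N.sweep ident layer first last x w = N.sweep ident layer first last y w :=
    fun k layer x y h w hw => sweep_congr fun a ha => h a (hw.trans ha)
  exact step 0 _ _ _ (step 1 _ _ _ (step 2 _ _ _ (step 3 _ _ _ (step 4 _ _ _ (step 5 _ _ _ h)))))
    v (Near.refl _ _)

theorem macroRound_erased (first last : Prop) (x : V → Cell) (v : V) :
    (N.macroRound ident first last x v).offers = ∅ ∧
      (N.macroRound ident first last x v).request = none ∧
      (N.macroRound ident first last x v).choice = none ∧
      (N.macroRound ident first last x v).grant = none := ⟨rfl, rfl, rfl, rfl⟩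

variable [Finite V] (hi : Function.Injective ident)
include hi

/-- A customer is assigned after `C * S` phases. -/
theorem target_ne_none_of_mul_le {L : ℕ} (hL : 0 < L) {C S p : ℕ} {c : V}
    (hr : N.role c = Role.customer) (hs : ∃ s, N.graph.Adj c s)
    (hC : (N.graph.neighborSet c).ncard ≤ C) (hS : N.ServerDegreeLE S 1 c) (hp : C * S ≤ p) :
    (N.phaseState ident L p 0 c).target ≠ none := by
  classical
  have := Fintype.ofFinite V
  intro hc
  -- Every customer that can be assigned on behalf of `c` lies in `Z`, as does `c` itself. Each
  -- phase in which `c` stays unassigned removes an unassigned member from it.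
  let Z : Finset V := (N.graph.neighborSet c).toFinset.biUnion fun s =>
    (N.graph.neighborSet s).toFinset
  have hZ : Z.card ≤ C * S := by
    refine (Finset.card_biUnion_le_card_mul _ _ S ?_).trans (Nat.mul_le_mul_right _ ?_)
    · intro s hs
      rw [Set.mem_toFinset] at hs
      rw [← Set.ncard_eq_toFinset_card']
      exact hS s (Near.of_adj hs) (role_server_of_adj hr hs)
    · rwa [← Set.ncard_eq_toFinset_card']
  have hmem : ∀ s d, N.graph.Adj c s → N.graph.Adj s d → d ∈ Z := fun s d h1 h2 =>
    Finset.mem_biUnion.2 ⟨s, Set.mem_toFinset.2 h1, Set.mem_toFinset.2 h2⟩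
  have key : ∀ q ≤ p,
      (Z.filter fun d => (N.phaseState ident L q 0 d).target = none).card + q ≤ Z.card := by
    intro q
    induction q with
    | zero => exact fun _ => Finset.card_filter_le _ _
    | succ q ih =>
      intro hq
      obtain ⟨req, go, h⟩ := exists_isPhase (N := N) hi hL q
      have hcq : (N.phaseState ident L q 0 c).target = none := by
        by_contra hcq
        exact target_ne_none_of_le hi hL (by omega) hcq hc
      obtain ⟨s, d, h1, h2, h3, h4⟩ := h.exists_assigned hL hr hcq hs
      rw [phaseState_length] at h4
      have : (Z.filter fun d => (N.phaseState ident L (q + 1) 0 d).target = none).card <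
          (Z.filter fun d => (N.phaseState ident L q 0 d).target = none).card := by
        refine Finset.card_lt_card ((Finset.ssubset_iff_of_subset ?_).2 ⟨d, ?_, ?_⟩)
        · intro e he
          rw [Finset.mem_filter] at he ⊢
          refine ⟨he.1, ?_⟩
          by_contra heq
          exact target_ne_none_of_le hi hL (Nat.le_succ q) heq he.2
        · exact Finset.mem_filter.2 ⟨hmem s d h1 h2, h3⟩
        · exact fun hd => h4 (Finset.mem_filter.1 hd).2
      have := ih (by omega)
      omega
  obtain ⟨s, hs⟩ := hs
  have h1 : 0 < (Z.filter fun d => (N.phaseState ident L p 0 d).target = none).card :=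
    Finset.card_pos.2 ⟨c, Finset.mem_filter.2 ⟨hmem s c hs hs.symm, hc⟩⟩
  have h2 := key p le_rfl
  omega

/-- A customer keeps its server once all customers in the vicinity are assigned. -/
theorem target_eq_of_assigned {L : ℕ} (hL : 0 < L) {S p q : ℕ} (hpq : p ≤ q) {c : V}
    (hd : N.ServerDegreeLE S (2 * S + 1) c)
    (ha : ∀ d, N.Near (2 * S + 2) c d → N.role d = Role.customer →
      (N.phaseState ident L p 0 d).target ≠ none) :
    (N.phaseState ident L q 0 c).target = (N.phaseState ident L p 0 c).target := by
  induction q, hpq using Nat.le_induction with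
  | base => rfl
  | succ q hpq ih =>
    obtain ⟨req, go, h⟩ := exists_isPhase (N := N) hi hL q
    rw [← ih, ← phaseState_length]
    exact h.target_eq_of_assigned hi hd
      (fun d h1 h2 => target_ne_none_of_le hi hL hpq (ha d h1 h2)) le_rfl

/-- Nothing changes in the later rounds of a phase. -/
theorem phaseState_succ_eq {L p S j : ℕ} (hj : j + 1 < L) (hS : S ^ 3 < j) {v : V}
    (hd : N.ServerDegreeLE S (2 * S + 4) v) :
    N.phaseState ident L p (j + 1) v = N.phaseState ident L p j v := by
  obtain ⟨req, go, h⟩ := exists_isPhase (N := N) hi (L := L) (by omega) p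
  have hr := h.round j (by omega)
  have hno : ∀ c, N.Near 1 v c → ∀ s, ¬ go j c s := fun c hc s hg => by
    have ho := hr.offers_of_go hg
    have := h.le_of_req hi (S := S) (by omega) (by omega) (hr.req_of_go hg)
      (hd.of_near (hc.trans (Near.of_adj ho.2.1)) (by omega))
    omega
  -- Since `j` is positive, both configurations are results of a full round, so their temporary
  -- fields are erased.
  obtain ⟨i, rfl⟩ : ∃ i, j = i + 1 := ⟨j - 1, by omega⟩
  have e1 := congrFun (phaseState_succ (N := N) (ident := ident) (p := p)
    (show i + 1 < L by omega)) v
  have e2 := congrFun (phaseState_succ (N := N) (ident := ident) (p := p) (show i < L by omega)) v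
  ext1
  · exact hr.target_stay (hno v (Near.refl _ _))
  · have := hr.moved_iff v
    simp only [hno v (Near.refl _ _), exists_false, or_false] at this
    exact propext (this.trans (and_iff_right (by omega)))
  · rw [h.load_eq (by omega), h.load_eq (by omega), count, count]
    congr 1
    ext c
    refine and_congr_right fun hc => ?_
    rw [hr.target_stay (hno c (Near.of_adj hc))]
  · rw [h.base_eq (by omega), h.base_eq (by omega)]
  all_goals
    rw [e1, e2]
    obtain ⟨a1, a2, a3, a4⟩ := macroRound_erased (N := N) (ident := ident) (i + 1 = 0)
      (i + 1 + 1 = L) (N.phaseState ident L p (i + 1)) v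
    obtain ⟨b1, b2, b3, b4⟩ := macroRound_erased (N := N) (ident := ident) (i = 0)
      (i + 1 = L) (N.phaseState ident L p i) v
    simp only [a1, a2, a3, a4, b1, b2, b3, b4]

/-- The state of a node at the start of a phase does not depend on the length of the phases, if
this length is large in comparison with the degrees in the vicinity. -/
theorem phaseState_eq_of_le {S L₀ L : ℕ} (hS : S ^ 3 + 2 ≤ L₀) (hL : L₀ ≤ L) {p : ℕ} {v : V}
    (hd : N.ServerDegreeLE S ((6 * L₀ + 2 * S + 10) * p) v) :
    N.phaseState ident L p 0 v = N.phaseState ident L₀ p 0 v := by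
  induction p generalizing v with
  | zero => rfl
  | succ p ih =>
    -- Before the last round of the shorter phase both runs apply the same rules. Information
    -- travels distance six per round, so the region of agreement shrinks by six each time.
    have hstart : ∀ j, j + 1 ≤ L₀ → ∀ w, N.Near (6 * (L₀ - j)) v w →
        N.phaseState ident L p j w = N.phaseState ident L₀ p j w := by
      intro j
      induction j with
      | zero =>
        intro _ w hw
        exact ih (hd.of_near hw (by rw [Nat.mul_succ]; omega))
      | succ j ihj =>
        intro hj w hw
        rw [phaseState_succ (show j < L by omega), phaseState_succ (show j < L₀ by omega),
          show (j + 1 = L) = False from eq_false (by omega),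
          show (j + 1 = L₀) = False from eq_false (by omega)]
        exact macroRound_congr fun a ha => ihj (by omega) a ((hw.trans ha).mono (by omega))
    obtain ⟨l, rfl⟩ : ∃ l, L₀ = l + 1 := ⟨L₀ - 1, by omega⟩
    obtain ⟨m, rfl⟩ : ∃ m, L = m + 1 := ⟨L - 1, by omega⟩
    -- As `l > S ^ 3`, the longer run idles from round `l` until its own last round, which then
    -- applies the same closing rule to the same nearby states. The radius `6 + (2 * S + 4)`
    -- accounts for the summand `2 * S + 10`.
    have hquiet : ∀ j, l ≤ j → j ≤ m → ∀ w, N.Near 6 v w →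
        N.phaseState ident (m + 1) p j w = N.phaseState ident (m + 1) p l w := by
      intro j hlj
      induction j, hlj using Nat.le_induction with
      | base => exact fun _ _ _ => rfl
      | succ j hlj ihj =>
        intro hj w hw
        rw [phaseState_succ_eq hi (S := S) (by omega) (by omega)
          (hd.of_near hw (by rw [Nat.mul_succ]; omega))]
        exact ihj (by omega) w hw
    rw [← phaseState_length, ← phaseState_length, phaseState_succ (Nat.lt_succ_self m),
      phaseState_succ (Nat.lt_succ_self l), show (m = 0) = False from eq_false (by omega),
      show (l = 0) = False from eq_false (by omega)]
    simp only [eq_self]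
    refine macroRound_congr fun w hw => ?_
    rw [hquiet m (by omega) le_rfl w hw]
    exact hstart l le_rfl w (hw.mono (by omega))

theorem isBalanced_phaseState {S L : ℕ} (hL : S ^ 3 + 2 ≤ L)
    (hS : ∀ v, N.ServerDegreeLE S (2 * S + 2) v) (p : ℕ) :
    N.IsBalanced ident (N.phaseState ident L p 0) := by
  induction p with
  | zero => exact fun c s s' _ _ => Nat.zero_le _
  | succ p ih =>
    obtain ⟨req, go, h⟩ := exists_isPhase (N := N) hi (L := L) (by omega) p
    rw [← phaseState_length]
    exact h.isBalanced hi hL hS ih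

end CustomerServerGraph

/-! ### The algorithm without global parameters -/

/-- The state of a node in the stable assignment algorithm: the dynamics for all lengths of the
phases at once, and bounds on the degrees of the nodes seen so far. -/
structure NodeState where
  time : ℕ
  degree : Role → ℕ
  id : ℕ
  role : Role
  run : ℕ → Cell

open Classical in
/-- The stable assignment algorithm: a customer stops when it has seen the whole neighbourhood of
a radius that suffices for the degrees in it. -/
noncomputable def stableAssignmentAlgorithm : LocalAlgorithm Role ℕ where
  State := NodeState
  Msg := NodeState
  start i r nbrs := ⟨0, fun r' => if r = r' then max 1 nbrs.ncard else 1, i, r, fun _ => Cell.init⟩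
  send q _ := q
  receive q M :=
    { time := q.time + 1
      degree := fun r => sSup (insert (q.degree r) ((fun m => m.2.degree r) '' M))
      id := q.id
      role := q.role
      run := fun L => Cell.step (q.time % 6) (q.time / 6 % L = 0) ((q.time / 6 + 1) % L = 0)
        q.id q.role (q.run L) ((fun m => (m.1, m.2.run L)) '' M) }
  output q := match q.role with
    | Role.server => some 0
    | Role.customer =>
      if q.time = 72 * (q.degree Role.customer * q.degree Role.server ^ 4) then
        (q.run (3 * q.degree Role.server ^ 3)).target
      else none

namespace LocalAlgorithm

variable {I O : Type} (A : LocalAlgorithm I O) {V : Type u}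
  (G : SimpleGraph V) (ident : V → ℕ) (input : V → I)

/-- If all outputs that a node is ready to announce agree, then this is its output. -/
theorem outputAt_eq_some {v : V} {o : O} {T : ℕ}
    (h : ∃ t ≤ T, (A.output (A.stateAt G ident input t v)).isSome)
    (ho : ∀ t ≤ T, ∀ o', A.output (A.stateAt G ident input t v) = some o' → o' = o) :
    A.outputAt G ident input T v = some o := by
  induction T with
  | zero =>
    obtain ⟨t, ht, hs⟩ := h
    obtain rfl : t = 0 := by omega
    obtain ⟨o', ho'⟩ := Option.isSome_iff_exists.1 hs
    rw [outputAt, ho', ho _ le_rfl _ ho']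
  | succ T ih =>
    rw [outputAt]
    by_cases hT : ∃ t ≤ T, (A.output (A.stateAt G ident input t v)).isSome
    · rw [ih hT fun t ht => ho t (by omega)]
    · have hn : A.outputAt G ident input T v = none := by
        push Not at hT
        clear ih h ho
        induction T with
        | zero => simpa [outputAt] using hT 0 le_rfl
        | succ T ih =>
          rw [outputAt, ih fun t ht => hT t (by omega)]
          simpa using hT (T + 1) le_rfl
      obtain ⟨t, ht, hs⟩ := h
      obtain rfl : t = T + 1 := by
        by_contra hne
        exact hT ⟨t, by omega, hs⟩
      obtain ⟨o', ho'⟩ := Option.isSome_iff_exists.1 hs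
      rw [hn]
      simp only [ho', ho _ le_rfl _ ho']

end LocalAlgorithm

namespace CustomerServerGraph

variable {V : Type u} (N : CustomerServerGraph V) (ident : V → ℕ)

/-- The state of a node that executes the stable assignment algorithm. -/
noncomputable def nodeState (t : ℕ) (v : V) : NodeState :=
  stableAssignmentAlgorithm.stateAt N.graph ident N.role t v

variable {N ident}

theorem nodeState_spec (t : ℕ) (v : V) : (N.nodeState ident t v).time = t ∧
    (N.nodeState ident t v).id = ident v ∧ (N.nodeState ident t v).role = N.role v ∧
    ∀ L, (N.nodeState ident t v).run L = N.trace ident L t v := by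
  induction t generalizing v with
  | zero => exact ⟨rfl, rfl, rfl, fun _ => rfl⟩
  | succ t ih =>
    obtain ⟨h1, h2, h3, h4⟩ := ih v
    refine ⟨congrArg (· + 1) h1, h2, h3, fun L => ?_⟩
    change Cell.step ((N.nodeState ident t v).time % 6) ((N.nodeState ident t v).time / 6 % L = 0)
      (((N.nodeState ident t v).time / 6 + 1) % L = 0) (N.nodeState ident t v).id
      (N.nodeState ident t v).role ((N.nodeState ident t v).run L)
      ((fun m : ℕ × NodeState => (m.1, m.2.run L)) ''
        ((fun w => (ident w, N.nodeState ident t w)) '' N.graph.neighborSet v)) = _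
    rw [h1, h2, h3, h4, Set.image_image]
    simp only [fun w => (ih w).2.2.2 L]
    rfl

theorem degree_succ (t : ℕ) (v : V) (r : Role) : (N.nodeState ident (t + 1) v).degree r =
    sSup (insert ((N.nodeState ident t v).degree r)
      ((fun w => (N.nodeState ident t w).degree r) '' N.graph.neighborSet v)) := by
  rw [← Set.image_image (fun m : ℕ × NodeState => m.2.degree r)
    (fun w => (ident w, N.nodeState ident t w))]
  rfl

theorem output_server {v : V} (hv : N.role v = Role.server) (t : ℕ) :
    stableAssignmentAlgorithm.output (N.nodeState ident t v) = some 0 := by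
  have := (nodeState_spec (N := N) (ident := ident) t v).2.2.1.trans hv
  simp only [stableAssignmentAlgorithm, this]

theorem output_customer {v : V} (hv : N.role v = Role.customer) (t : ℕ) :
    stableAssignmentAlgorithm.output (N.nodeState ident t v) =
      if t = 72 * ((N.nodeState ident t v).degree Role.customer *
        (N.nodeState ident t v).degree Role.server ^ 4) then
        (N.trace ident (3 * (N.nodeState ident t v).degree Role.server ^ 3) t v).target
      else none := by
  obtain ⟨h1, -, h3, h4⟩ := nodeState_spec (N := N) (ident := ident) t v
  simp only [stableAssignmentAlgorithm, h3.trans hv, h1, h4]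

theorem Near.cases_succ {t : ℕ} {v w : V} (h : N.Near (t + 1) v w) :
    N.Near t v w ∨ ∃ u, N.graph.Adj v u ∧ N.Near t u w := by
  obtain ⟨p, hp⟩ := h
  cases p with
  | nil => exact Or.inl (Near.refl _ _)
  | cons ha q => exact Or.inr ⟨_, ha, q, by simpa using hp⟩

variable [Finite V]

theorem degree_le_degree_succ (t : ℕ) (v : V) (r : Role) :
    (N.nodeState ident t v).degree r ≤ (N.nodeState ident (t + 1) v).degree r := by
  rw [degree_succ]
  exact le_csSup (Set.toFinite _).bddAbove (Set.mem_insert _ _)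

theorem degree_le_degree_succ_of_adj (t : ℕ) {v w : V} (h : N.graph.Adj v w) (r : Role) :
    (N.nodeState ident t w).degree r ≤ (N.nodeState ident (t + 1) v).degree r := by
  rw [degree_succ]
  exact le_csSup (Set.toFinite _).bddAbove (Set.mem_insert_of_mem _ ⟨w, h, rfl⟩)

omit [Finite V] in
theorem degree_zero (v : V) (r : Role) : (N.nodeState ident 0 v).degree r =
    open Classical in if N.role v = r then max 1 (ident '' N.graph.neighborSet v).ncard else 1 :=
  rfl

theorem one_le_degree (t : ℕ) (v : V) (r : Role) : 1 ≤ (N.nodeState ident t v).degree r := by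
  induction t with
  | zero =>
    rw [degree_zero]
    split_ifs
    · exact le_max_left _ _
    · exact le_rfl
  | succ t ih => exact ih.trans (degree_le_degree_succ t v r)

/-- Degree information travels one edge per round, so after `t` rounds the recorded maxima are valid
on the ball of radius `t`. -/
theorem ncard_le_degree (hi : Function.Injective ident) {t : ℕ} {v w : V} (h : N.Near t v w) :
    (N.graph.neighborSet w).ncard ≤ (N.nodeState ident t v).degree (N.role w) := by
  induction t generalizing v with
  | zero =>
    obtain ⟨p, hp⟩ := h
    obtain rfl := SimpleGraph.Walk.eq_of_length_eq_zero (Nat.le_zero.1 hp)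
    rw [degree_zero, if_pos rfl, Set.ncard_image_of_injective _ hi]
    exact le_max_right _ _
  | succ t ih =>
    rcases h.cases_succ with h | ⟨u, hu, h⟩
    · exact (ih h).trans (degree_le_degree_succ t v _)
    · exact (ih h).trans (degree_le_degree_succ_of_adj t hu _)

omit [Finite V] in
theorem degree_le (hi : Function.Injective ident) {B : ℕ} {r : Role} (hB : 1 ≤ B)
    (h : ∀ v, N.role v = r → (N.graph.neighborSet v).ncard ≤ B) (t : ℕ) (v : V) :
    (N.nodeState ident t v).degree r ≤ B := by
  induction t generalizing v with
  | zero =>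
    rw [degree_zero]
    split_ifs with hr
    · rw [Set.ncard_image_of_injective _ hi]
      exact max_le hB (h v hr)
    · exact hB
  | succ t ih =>
    rw [degree_succ]
    refine csSup_le (Set.insert_nonempty _ _) ?_
    rintro d (rfl | ⟨w, -, rfl⟩)
    · exact ih v
    · exact ih w

theorem ncard_le_maxDegree (v : V) :
    (N.graph.neighborSet v).ncard ≤ N.maxDegree (N.role v) :=
  le_csSup (Set.toFinite _).bddAbove ⟨v, rfl, rfl⟩

/-- The output of a customer is its server in the long run of the dynamics with long phases. -/
theorem target_eq_of_time (hi : Function.Injective ident)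
    (hN : ∀ c : N.Customer, ∃ s : V, N.graph.Adj c s) {C S : ℕ} (hC : 1 ≤ C) (hS : 1 ≤ S)
    (hCv : ∀ v, N.role v = Role.customer → (N.graph.neighborSet v).ncard ≤ C)
    (hSv : ∀ v, N.role v = Role.server → (N.graph.neighborSet v).ncard ≤ S)
    {c : V} {t : ℕ}
    (ht : t = 72 * ((N.nodeState ident t c).degree Role.customer *
      (N.nodeState ident t c).degree Role.server ^ 4)) :
    (N.trace ident (3 * (N.nodeState ident t c).degree Role.server ^ 3) t c).target =
      (N.phaseState ident (3 * S ^ 3) (C * S) 0 c).target := by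
  obtain ⟨D, hD⟩ : ∃ D, D = (N.nodeState ident t c).degree Role.customer := ⟨_, rfl⟩
  obtain ⟨R, hR⟩ : ∃ R, R = (N.nodeState ident t c).degree Role.server := ⟨_, rfl⟩
  rw [← hD, ← hR] at ht
  rw [← hR]
  have hD1 : 1 ≤ D := hD ▸ one_le_degree t c _
  have hR1 : 1 ≤ R := hR ▸ one_le_degree t c _
  have hDC : D ≤ C := hD ▸ degree_le hi hC hCv t c
  have hRS : R ≤ S := hR ▸ degree_le hi hS hSv t c
  have hball : N.ServerDegreeLE R t c := fun w hw hr => by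
    have := ncard_le_degree hi hw
    rwa [hr, ← hR] at this
  have hpow : R ≤ R ^ 3 := Nat.le_self_pow (by norm_num) R
  have hpow1 : 1 ≤ R ^ 3 := Nat.one_le_pow _ _ hR1
  -- The constant is `72 = 6 * 3 * 4`: six communication rounds per round of token dropping, phases
  -- of `3 * R ^ 3` rounds, and `4 * (D * R)` phases.
  have htime : t = 6 * (3 * R ^ 3 * (4 * (D * R)) + 0) := by rw [ht]; ring
  have hDR : 1 ≤ D * R := Nat.mul_pos hD1 hR1
  -- Only `D * R` phases are needed for assignment. The further phases make the ball of radius `t`,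
  -- on which `R` bounds the server degrees, large enough for the comparison of phase lengths.
  have hradius : (6 * (3 * R ^ 3) + 2 * R + 10) * (D * R) ≤ t := by
    calc (6 * (3 * R ^ 3) + 2 * R + 10) * (D * R) ≤ (72 * R ^ 3) * (D * R) :=
          Nat.mul_le_mul_right _ (by omega)
      _ = t := by rw [ht]; ring
  have hradius' : 2 * R + 3 ≤ t := by
    refine le_trans ?_ hradius
    calc 2 * R + 3 ≤ (6 * (3 * R ^ 3) + 2 * R + 10) * 1 := by omega
      _ ≤ _ := Nat.mul_le_mul_left _ hDR
  have hassigned : ∀ L, 0 < L → ∀ d, N.Near (2 * R + 2) c d → N.role d = Role.customer →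
      (N.phaseState ident L (D * R) 0 d).target ≠ none := by
    intro L hL d hd hr
    refine target_ne_none_of_mul_le hi hL (C := D) (S := R) hr (hN ⟨d, hr⟩) ?_
      (hball.of_near hd (by omega)) le_rfl
    have := ncard_le_degree (ident := ident) hi (hd.mono (show 2 * R + 2 ≤ t by omega))
    rwa [hr, ← hD] at this
  have hfix : ∀ L, 0 < L → ∀ q, D * R ≤ q → (N.phaseState ident L q 0 c).target =
      (N.phaseState ident L (D * R) 0 c).target := fun L hL q hq =>
    target_eq_of_assigned hi hL hq (hball.mono (by omega)) (hassigned L hL)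
  have hle : 3 * R ^ 3 ≤ 3 * S ^ 3 := Nat.mul_le_mul_left _ (Nat.pow_le_pow_left hRS 3)
  rw [htime]
  change (N.phaseState ident (3 * R ^ 3) (4 * (D * R)) 0 c).target = _
  -- In both runs the target is frozen from phase `D * R` on, and at that phase the runs agree near
  -- `c`.
  rw [hfix _ (by omega) _ (by omega), hfix _ (by omega) _ (Nat.mul_le_mul hDC hRS),
    phaseState_eq_of_le hi (S := R) (by omega) hle (hball.mono hradius)]

omit [Finite V] in
theorem load_eq_count (hi : Function.Injective ident) {x : V → Cell} {σ : N.Customer → V}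
    (hσ : ∀ c : N.Customer, N.graph.Adj c (σ c) ∧ (x c).target = some (ident (σ c)))
    (hx : ∀ v i, (x v).target = some i → N.role v = Role.customer) (s : V) :
    N.load σ s = N.count ident x s := by
  rw [load, count, ← Set.ncard_image_of_injective _ Subtype.val_injective]
  congr 1
  ext c
  constructor
  · rintro ⟨c, rfl, rfl⟩
    exact ⟨(hσ c).1.symm, (hσ c).2⟩
  · rintro ⟨-, h2⟩
    exact ⟨⟨c, hx c _ h2⟩, hi (Option.some.inj ((hσ ⟨c, hx c _ h2⟩).2.symm.trans h2)), rfl⟩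

/-- The threshold is nondecreasing in time and bounded. At the first time `t` that reaches it, `t -
1` was still below the previous threshold, so `t` does not exceed the present one and equality
holds. -/
theorem exists_time (hi : Function.Injective ident) {C S : ℕ} (hC : 1 ≤ C) (hS : 1 ≤ S)
    (hCv : ∀ v, N.role v = Role.customer → (N.graph.neighborSet v).ncard ≤ C)
    (hSv : ∀ v, N.role v = Role.server → (N.graph.neighborSet v).ncard ≤ S) (v : V) :
    ∃ t ≤ 72 * (C * S ^ 4), t = 72 * ((N.nodeState ident t v).degree Role.customer *
      (N.nodeState ident t v).degree Role.server ^ 4) := by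
  classical
  have hex : ∃ t, 72 * ((N.nodeState ident t v).degree Role.customer *
      (N.nodeState ident t v).degree Role.server ^ 4) ≤ t :=
    ⟨72 * (C * S ^ 4), Nat.mul_le_mul_left _ (Nat.mul_le_mul (degree_le hi hC hCv _ v)
      (Nat.pow_le_pow_left (degree_le hi hS hSv _ v) 4))⟩
  refine ⟨Nat.find hex, Nat.find_min' hex (Nat.mul_le_mul_left _ (Nat.mul_le_mul
    (degree_le hi hC hCv _ v) (Nat.pow_le_pow_left (degree_le hi hS hSv _ v) 4))),
    le_antisymm ?_ (Nat.find_spec hex)⟩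
  rcases hf : Nat.find hex with _ | t
  · exact Nat.zero_le _
  · have h1 := Nat.find_min hex (show t < Nat.find hex by omega)
    have h2 : 72 * ((N.nodeState ident t v).degree Role.customer *
        (N.nodeState ident t v).degree Role.server ^ 4) ≤
        72 * ((N.nodeState ident (t + 1) v).degree Role.customer *
        (N.nodeState ident (t + 1) v).degree Role.server ^ 4) :=
      Nat.mul_le_mul_left _ (Nat.mul_le_mul (degree_le_degree_succ t v _)
        (Nat.pow_le_pow_left (degree_le_degree_succ t v _) 4))
    omega

end CustomerServerGraph

/-! ### The main theorem -/

open CustomerServerGraph in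
theorem mainTheorem4 :
    ∃ (K : ℕ) (A : LocalAlgorithm Role ℕ),
      ∀ (V : Type u) [Finite V] (N : CustomerServerGraph V) (ident : V → ℕ),
        Function.Injective ident →
        (∀ c : N.Customer, ∃ s : V, N.graph.Adj c s) →
        SolvesStableAssignmentWithin A N ident
          (K * (N.maxDegree Role.customer * N.maxDegree Role.server ^ 4)) := by
  refine ⟨72, stableAssignmentAlgorithm, fun V _ N ident hi hN => ?_⟩
  obtain ⟨C, hC⟩ : ∃ C, C = N.maxDegree Role.customer := ⟨_, rfl⟩
  obtain ⟨S, hS⟩ : ∃ S, S = N.maxDegree Role.server := ⟨_, rfl⟩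
  rw [← hC, ← hS]
  have hCv : ∀ v, N.role v = Role.customer → (N.graph.neighborSet v).ncard ≤ C := fun v hv =>
    hC ▸ hv ▸ ncard_le_maxDegree v
  have hSv : ∀ v, N.role v = Role.server → (N.graph.neighborSet v).ncard ≤ S := fun v hv =>
    hS ▸ hv ▸ ncard_le_maxDegree v
  have hpos : ∀ v, N.role v = Role.customer → 1 ≤ C ∧ 1 ≤ S := by
    intro c hc
    obtain ⟨s, hs⟩ := hN ⟨c, hc⟩
    exact ⟨le_trans ((Set.ncard_pos (Set.toFinite _)).2 ⟨s, hs⟩) (hCv c hc),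
      le_trans ((Set.ncard_pos (Set.toFinite _)).2 ⟨c, hs.symm⟩)
        (hSv s (role_server_of_adj hc hs))⟩
  let x : V → Cell := N.phaseState ident (3 * S ^ 3) (C * S) 0
  have hadj : ∀ c : N.Customer, ∃ s, N.graph.Adj c s ∧ (x c).target = some (ident s) := by
    intro c
    have hS1 : 1 ≤ S ^ 3 := Nat.one_le_pow _ _ (hpos c c.2).2
    have hL : 0 < 3 * S ^ 3 := by omega
    have h := target_ne_none_of_mul_le hi hL c.2 (hN c) (hCv c c.2) (fun w _ => hSv w) le_rfl
    obtain ⟨i, hi'⟩ := Option.ne_none_iff_exists'.1 h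
    obtain ⟨req, go, hp⟩ := exists_isPhase (N := N) hi hL (C * S)
    obtain ⟨-, s, hs, rfl⟩ := hp.adj_zero c i hi'
    exact ⟨s, hs, hi'⟩
  choose σ hσ using hadj
  have hout : ∀ c : N.Customer, stableAssignmentAlgorithm.outputAt N.graph ident N.role
      (72 * (C * S ^ 4)) c = some (ident (σ c)) := by
    intro c
    obtain ⟨hC1, hS1⟩ := hpos c c.2
    -- The stopping condition may hold at several times, but each of them gives the target in the
    -- common reference run `x`.
    have htarget := fun t ht => target_eq_of_time hi hN hC1 hS1 hCv hSv (c := c) (t := t) ht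
    refine LocalAlgorithm.outputAt_eq_some _ _ _ _ ?_ ?_
    · obtain ⟨t, ht1, ht2⟩ := exists_time hi hC1 hS1 hCv hSv c.1
      refine ⟨t, ht1, ?_⟩
      change (stableAssignmentAlgorithm.output (N.nodeState ident t c)).isSome
      rw [output_customer c.2, if_pos ht2, htarget t ht2]
      exact Option.isSome_iff_exists.2 ⟨_, (hσ c).2⟩
    · intro t _ o ho
      change stableAssignmentAlgorithm.output (N.nodeState ident t c) = some o at ho
      rw [output_customer c.2] at ho
      split_ifs at ho with ht
      rw [htarget t ht] at ho
      exact Option.some.inj (ho.symm.trans (hσ c).2)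
  refine ⟨fun v => ?_, σ, ⟨fun c => (hσ c).1, fun c s hs _ => ?_⟩, hout⟩
  · cases hv : N.role v
    · rw [hout ⟨v, hv⟩]
      rfl
    · refine Option.isSome_iff_exists.2 ⟨0, LocalAlgorithm.outputAt_eq_some _ _ _ _
        ⟨0, Nat.zero_le _, ?_⟩ fun t _ o ho => ?_⟩
      · exact Option.isSome_iff_exists.2 ⟨0, output_server hv 0⟩
      · exact Option.some.inj (ho.symm.trans (output_server hv t))
  -- For `S ≥ 1` the phase length `3 * S ^ 3` is at least `S ^ 3 + 2`, as the balance invariant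
  -- requires.
  · have hS1 : 1 ≤ S ^ 3 := Nat.one_le_pow _ _ (hpos c c.2).2
    have hL : 0 < 3 * S ^ 3 := by omega
    obtain ⟨req, go, hp⟩ := exists_isPhase (N := N) hi hL (C * S)
    have hload : ∀ s, N.load σ s = (x s).load := fun s =>
      (load_eq_count hi hσ (fun v i hv => (hp.adj_zero v i hv).1) s).trans (hp.load_zero s).symm
    rw [hload, hload]
    exact isBalanced_phaseState hi (by omega) (fun v w _ => hSv w) (C * S) c (σ c) s (hσ c).2 hs
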